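/- **Setting.** All Hilbert spaces are finite-dimensional, $\log$ is to base $2$ with $0\log 0=0$, and powers of positive semi-definite operators with negative exponent are powers of the pseudoinverse. Write $\sigma\gg\rho$ if $\ker\sigma\subseteq\ker\rho$, and $\rho\perp\sigma$ if $\rho\sigma=0$. For a density operator $\rho$, a positive semi-definite $\sigma$ and $\alpha\in(0,1)\cup(1,\infty)$ the sandwiched Rényi divergence is $$D_\alpha(\rho\|\sigma)=\frac{1}{\alpha-1}\log\operatorname{tr}\Big[\big(\sigma^{\frac{1-\alpha}{2\alpha}}\rho\,\sigma^{\frac{1-\alpha}{2\alpha}}\big)^{\alpha}\Big]\quad\text{if }\rho\not\perp\sigma\text{ and }(\sigma\gg\rho\text{ or }\alpha<1),$$ and $D_\alpha(\rho\|\sigma)=+\infty$ otherwise. Further, $D_1(\rho\|\sigma)=\operatorname{tr}[\rho(\log\rho-\log\sigma)]$ if $\sigma\gg\rho$ and $+\infty$ otherwise, and $D_0=\lim_{\alpha\to0^+}D_\alpha$. The Rényi entropy of order $\alpha>0$ is $H_\alpha(\rho)=\frac{1}{1-\alpha}\log\operatorname{tr}\rho^\alpha$ for $\alpha\ne1$,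 and $H_1(\rho)=-\operatorname{tr}(\rho\log\rho)$. For a density operator $\rho_{AB}$ on $\mathcal H_A\otimes\mathcal H_B$ and a positive semi-definite $\tau_A$ on $\mathcal H_A$ put $$H_\alpha(\rho_{AB}\|\tau_A)=-D_\alpha(\rho_{AB}\|\tau_A\otimes 1_B),\qquad I_\alpha(\rho_{AB}\|\tau_A)=\inf_{\sigma_B}D_\alpha(\rho_{AB}\|\tau_A\otimes\sigma_B),$$ the infimum being over all density operators $\sigma_B$ on $\mathcal H_B$, and $\rho_B=\operatorname{tr}_A\rho_{AB}$. **Theorem.** Let $\alpha\ge0$, $\beta>\frac12$, $\gamma\ge\frac12$ be real numbers with $$\alpha\beta\gamma-2\beta\gamma-\alpha+\beta+\gamma=0 .$$ Let $\rho_{AB}$ be a density operator on $\mathcal H_A\otimes\mathcal H_B$ and $\tau_A$ a positive semi-definite operator on $\mathcal H_A$. Then, as (in)equalities between extended real numbers: 1. if $\frac1\beta+\frac1\gamma\le2$, and moreover $\alpha\le1$ in case $\frac1\beta+\frac1\gamma=2$, then $$I_\beta(\rho_{AB}\|\tau_A)\ \ge\ H_\gamma(\rho_B)-H_\alpha(\rho_{AB}\|\tau_A);$$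 2. if $\frac1\beta+\frac1\gamma\ge2$, and moreover $\alpha\ge1$ in case $\frac1\beta+\frac1\gamma=2$, then $$I_\beta(\rho_{AB}\|\tau_A)\ \le\ H_\gamma(\rho_B)-H_\alpha(\rho_{AB}\|\tau_A).$$ -/

import Mathlib

open scoped Kronecker Topology ComplexOrder

noncomputable section

namespace Renyi

/-! Operators on a finite-dimensional Hilbert space with orthonormal basis indexed by `n` are complex
matrices over `n`; the tensor product of two such spaces has basis indexed by the product type. -/

/-- Density operators: positive semi-definite with unit trace. -/
def IsDensity {n : Type*} [Fintype n] (ρ : Matrix n n ℂ) : Prop :=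
  ρ.PosSemidef ∧ ρ.trace = 1

/-- `Dominates σ ρ`, written `σ ≫ ρ`: the kernel of `σ` is contained in the kernel of `ρ`. -/
def Dominates {n : Type*} [Fintype n] (σ ρ : Matrix n n ℂ) : Prop :=
  ∀ v : n → ℂ, σ.mulVec v = 0 → ρ.mulVec v = 0

/-- Orthogonality `ρ ⊥ σ` of positive operators: their supports are orthogonal. -/
def Orthogonal {n : Type*} [Fintype n] (ρ σ : Matrix n n ℂ) : Prop :=
  ρ * σ = 0

/-- The real power `M ^ r` of a positive semi-definite matrix, by functional calculus. As
`(0 : ℝ) ^ r = 0` for `r ≠ 0`, negative powers are powers of the pseudoinverse. -/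
def mpow {n : Type*} [Fintype n] [DecidableEq n] (M : Matrix n n ℂ) (r : ℝ) : Matrix n n ℂ :=
  cfc (fun x : ℝ => x ^ r) M

/-- The base-2 logarithm of a positive semi-definite matrix, by functional calculus, taken to vanish
on the kernel (the convention `0 log 0 = 0`). -/
def mlog {n : Type*} [Fintype n] [DecidableEq n] (M : Matrix n n ℂ) : Matrix n n ℂ :=
  cfc (fun x : ℝ => Real.logb 2 x) M

/-- `tr[(σ^((1-α)/(2α)) ρ σ^((1-α)/(2α)))^α]`. -/
def sandwichedTrace {n : Type*} [Fintype n] [DecidableEq n] (α : ℝ) (ρ σ : Matrix n n ℂ) : ℝ :=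
  (mpow (mpow σ ((1 - α) / (2 * α)) * ρ * mpow σ ((1 - α) / (2 * α))) α).trace.re

open Classical in
/-- The sandwiched Rényi divergence `D_α(ρ‖σ)` for `α ∈ (0,1) ∪ (1,∞)`. -/
def sandwichedDiv {n : Type*} [Fintype n] [DecidableEq n] (α : ℝ) (ρ σ : Matrix n n ℂ) : EReal :=
  if ¬ Orthogonal ρ σ ∧ (Dominates σ ρ ∨ α < 1) then
    (((1 / (α - 1)) * Real.logb 2 (sandwichedTrace α ρ σ) : ℝ) : EReal)
  else ⊤

open Classical in
/-- The quantum relative entropy `D(ρ‖σ) = tr[ρ (log ρ - log σ)]`, infinite unless `σ ≫ ρ`. -/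
def relEntropy {n : Type*} [Fintype n] [DecidableEq n] (ρ σ : Matrix n n ℂ) : EReal :=
  if Dominates σ ρ then (((ρ * (mlog ρ - mlog σ)).trace.re : ℝ) : EReal) else ⊤

open Classical in
/-- The Rényi divergence `D_α(ρ‖σ)` of every order `α ≥ 0`: the sandwiched divergence for `α ≠ 0, 1`,
the relative entropy for `α = 1`, and the limit `α → 0⁺` for `α = 0`. (The sandwiched divergence is
monotone in `α`, so this limit exists in the extended reals and equals the upper limit.) -/
def renyiDiv {n : Type*} [Fintype n] [DecidableEq n] (α : ℝ) (ρ σ : Matrix n n ℂ) : EReal :=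
  if α = 0 then Filter.limsup (fun a : ℝ => sandwichedDiv a ρ σ) (𝓝[>] 0)
  else if α = 1 then relEntropy ρ σ
  else sandwichedDiv α ρ σ

open Classical in
/-- The quantum Rényi entropy `H_α(ρ)` of order `α > 0`; it is the von Neumann entropy for `α = 1`. -/
def renyiEntropy {n : Type*} [Fintype n] [DecidableEq n] (α : ℝ) (ρ : Matrix n n ℂ) : ℝ :=
  if α = 1 then -(ρ * mlog ρ).trace.re
  else (1 / (1 - α)) * Real.logb 2 (mpow ρ α).trace.re

/-- The reduced state on the second factor, `ρ_B = tr_A ρ_AB`. -/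
def reducedRight {A B : Type*} [Fintype A] (ρ : Matrix (A × B) (A × B) ℂ) : Matrix B B ℂ :=
  Matrix.of fun j j' => ∑ i, ρ (i, j) (i, j')

/-- The generalised conditional entropy `H_α(ρ_AB‖τ_A) = -D_α(ρ_AB‖τ_A ⊗ 1_B)`. -/
def condEntropy {A B : Type*} [Fintype A] [DecidableEq A] [Fintype B] [DecidableEq B]
    (α : ℝ) (ρ : Matrix (A × B) (A × B) ℂ) (τ : Matrix A A ℂ) : EReal :=
  -renyiDiv α ρ (τ ⊗ₖ (1 : Matrix B B ℂ))

/-- The generalised mutual information `I_α(ρ_AB‖τ_A) = inf_{σ_B} D_α(ρ_AB‖τ_A ⊗ σ_B)`, the infimum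
being over density operators `σ_B`. -/
def mutualInfo {A B : Type*} [Fintype A] [DecidableEq A] [Fintype B] [DecidableEq B]
    (α : ℝ) (ρ : Matrix (A × B) (A × B) ℂ) (τ : Matrix A A ℂ) : EReal :=
  ⨅ (σ : Matrix B B ℂ) (_ : IsDensity σ), renyiDiv α ρ (τ ⊗ₖ σ)

end Renyi

end

/-! Write ρ = X Xᴴ and p̂ = (p-1)/p. The sandwiched operator and Xᴴ κ^(-p̂) X have the same
spectrum, so D_p(ρ‖κ) = (1/p̂) log ‖Xᴴ κ^(-p̂) X‖_p; likewise -H_p(ρ_B) = (1/p̂) log ‖ρ_B‖_p.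
Hölder's inequality bounds tr(L ω^p̂) above by ‖L‖_p for p > 1, the reverse inequality bounds it
below for p < 1, and ω ∝ L^p attains both. As p̂ changes sign at p = 1, in both cases (1/p̂) log
‖L‖_p is the maximum of (1/p̂) log tr(L ω^p̂) over density operators ω, whose support must contain
that of L when p < 1 (`one_div_hat_mul_logb_le`, `exists_sum_diagEntry_mul_eq_schatten`).

In eigenbases y_i of κ and w_k of ω the numbers P(i,k) = |⟨y_i, X w_k⟩|² form a probability
distribution, and the trace becomes the classical moment E_P[(w/d)^p̂], d and w being the
eigenvalues. A product eigenbasis of τ ⊗ σ serves τ ⊗ 1 as well, with eigenvalues ts and t, and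
E_P[s^γ̂] = tr(ρ_B σ^γ̂). The relation between the orders says 1/α̂ = 1/β̂ + 1/γ̂, and w/t =
(w/(ts))·s, so the three moments are compared by the classical Hölder inequality; the signs of α̂,
β̂, γ̂ decide its direction. For the lower bound σ is arbitrary and ω is optimal for α
(`chain_lower_bound`); for the upper bound σ is optimal for γ and ω for β (`chain_upper_bound`).

If β or γ equals 1, the claim is interpolated through the chain rule for the relative entropy, using
D_p ≤ D_1 ≤ D_q for p ≤ 1 ≤ q, which is Jensen's inequality for the same P. The order α = 0 is a
limit of positive orders (`renyiEntropy_add_limsup_le`). -/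

namespace Renyi

open Matrix

/-! ### Functional calculus and traces in explicit eigenbases. -/

section Diagonal

variable {n m : Type*} [Fintype n] [DecidableEq n] [Fintype m] [DecidableEq m]

/-- The matrix `U diag(d) Uᴴ`. -/
def conjDiag (U : Matrix n n ℂ) (d : n → ℝ) : Matrix n n ℂ :=
  U * diagonal (fun i => (d i : ℂ)) * Uᴴ

/-- The `k`-th diagonal entry of `M` in the basis formed by the columns of `W`. -/
def diagEntry (W M : Matrix n n ℂ) (k : n) : ℝ := ((Wᴴ * M * W) k k).re

/-- The squared moduli of the entries of `X` in the bases `Y` (left) and `W` (right). -/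
def weight (Y X W : Matrix n n ℂ) (i k : n) : ℝ := Complex.normSq ((Yᴴ * X * W) i k)

lemma conjTranspose_mul_self_of_unitary {U : Matrix n n ℂ} (hU : U ∈ unitaryGroup n ℂ) :
    Uᴴ * U = 1 := by
  simpa [star_eq_conjTranspose] using mem_unitaryGroup_iff'.mp hU

lemma mul_conjTranspose_self_of_unitary {U : Matrix n n ℂ} (hU : U ∈ unitaryGroup n ℂ) :
    U * Uᴴ = 1 := by
  simpa [star_eq_conjTranspose] using mem_unitaryGroup_iff.mp hU

lemma conjDiag_mul {U : Matrix n n ℂ} (hU : U ∈ unitaryGroup n ℂ) (d e : n → ℝ) :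
    conjDiag U d * conjDiag U e = conjDiag U (fun i => d i * e i) := by
  have h := conjTranspose_mul_self_of_unitary hU
  unfold conjDiag
  calc _ = U * diagonal (fun i => (d i : ℂ)) * (Uᴴ * U) * diagonal (fun i => (e i : ℂ)) * Uᴴ := by
        simp only [Matrix.mul_assoc]
    _ = U * (diagonal (fun i => (d i : ℂ)) * diagonal (fun i => (e i : ℂ))) * Uᴴ := by
        rw [h]; simp only [Matrix.mul_assoc, Matrix.one_mul]
    _ = _ := by rw [diagonal_mul_diagonal]; simp

lemma conjDiag_one {U : Matrix n n ℂ} (hU : U ∈ unitaryGroup n ℂ) :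
    conjDiag U (fun _ => 1) = 1 := by
  simp [conjDiag, mul_conjTranspose_self_of_unitary hU]

lemma conjDiag_add (U : Matrix n n ℂ) (d e : n → ℝ) :
    conjDiag U d + conjDiag U e = conjDiag U (fun i => d i + e i) := by
  simp [conjDiag, ← Matrix.mul_add, ← Matrix.add_mul, diagonal_add]

lemma conjDiag_pow {U : Matrix n n ℂ} (hU : U ∈ unitaryGroup n ℂ) (d : n → ℝ) (k : ℕ) :
    conjDiag U d ^ k = conjDiag U (fun i => d i ^ k) := by
  induction k with
  | zero => simp [conjDiag_one hU]
  | succ k ih => rw [pow_succ, ih, conjDiag_mul hU]; simp [pow_succ]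

lemma conjDiag_conjTranspose (U : Matrix n n ℂ) (d : n → ℝ) :
    (conjDiag U d)ᴴ = conjDiag U d := by
  have : star (fun i => (d i : ℂ)) = fun i => (d i : ℂ) := by ext i; simp
  simp [conjDiag, Matrix.mul_assoc, diagonal_conjTranspose, this]

lemma conjDiag_posSemidef (U : Matrix n n ℂ) {d : n → ℝ} (hd : ∀ i, 0 ≤ d i) :
    (conjDiag U d).PosSemidef := by
  refine PosSemidef.mul_mul_conjTranspose_same (posSemidef_diagonal_iff.mpr fun i => ?_) U
  exact_mod_cast hd i

lemma aeval_conjDiag {U : Matrix n n ℂ} (hU : U ∈ unitaryGroup n ℂ) (d : n → ℝ)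
    (p : Polynomial ℝ) :
    Polynomial.aeval (conjDiag U d) p = conjDiag U (fun i => p.eval (d i)) := by
  induction p using Polynomial.induction_on' with
  | add p q hp hq => simp [hp, hq, conjDiag_add]
  | monomial k a =>
    rw [Polynomial.aeval_monomial, conjDiag_pow hU]
    simp only [Polynomial.eval_monomial]
    have : (algebraMap ℝ (Matrix n n ℂ)) a = conjDiag U (fun _ => a) := by
      have h1 : diagonal (fun _ : n => (a : ℂ)) = (a : ℂ) • (1 : Matrix n n ℂ) := by
        ext i j; by_cases h : i = j <;> simp [h, diagonal]
      rw [conjDiag, h1]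
      simp only [Matrix.mul_smul, Matrix.smul_mul, Matrix.mul_one,
        mul_conjTranspose_self_of_unitary hU]
      ext i j
      by_cases h : i = j <;> simp [h, algebraMap_matrix_apply]
    rw [this, conjDiag_mul hU]

/-- On a finite set every function agrees with a polynomial. Interpolating on the spectrum together
with the values of `d` avoids having to identify the two sets. -/
lemma cfc_conjDiag {U : Matrix n n ℂ} (hU : U ∈ unitaryGroup n ℂ) (d : n → ℝ) (f : ℝ → ℝ) :
    cfc f (conjDiag U d) = conjDiag U (fun i => f (d i)) := by
  have hsa : IsSelfAdjoint (conjDiag U d) := conjDiag_conjTranspose U d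
  have hfin := (Matrix.finite_real_spectrum (A := conjDiag U d)).union (Set.finite_range d)
  set s := hfin.toFinset with hs
  have hp : ∀ x ∈ s, (Lagrange.interpolate s id f).eval x = f x := fun x hx =>
    Lagrange.eval_interpolate_at_node f (Set.injOn_id _) hx
  set p := Lagrange.interpolate s id f
  have h1 : cfc f (conjDiag U d) = cfc p.eval (conjDiag U d) :=
    cfc_congr fun x hx => (hp x (by simp [hs]; exact Or.inl hx)).symm
  rw [h1, cfc_polynomial p _ hsa, aeval_conjDiag hU]
  congr 1
  ext i
  exact hp _ (by simp [hs])

lemma mpow_conjDiag {U : Matrix n n ℂ} (hU : U ∈ unitaryGroup n ℂ) (d : n → ℝ) (r : ℝ) :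
    mpow (conjDiag U d) r = conjDiag U (fun i => d i ^ r) :=
  cfc_conjDiag hU d _

lemma mlog_conjDiag {U : Matrix n n ℂ} (hU : U ∈ unitaryGroup n ℂ) (d : n → ℝ) :
    mlog (conjDiag U d) = conjDiag U (fun i => Real.logb 2 (d i)) :=
  cfc_conjDiag hU d _

lemma trace_conjDiag {U : Matrix n n ℂ} (hU : U ∈ unitaryGroup n ℂ) (d : n → ℝ) :
    (conjDiag U d).trace = ((∑ i, d i : ℝ) : ℂ) := by
  rw [conjDiag, Matrix.mul_assoc, trace_mul_comm, Matrix.mul_assoc,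
    conjTranspose_mul_self_of_unitary hU]
  simp [trace_diagonal]

lemma isHermitian_eq_conjDiag {M : Matrix n n ℂ} (hM : M.IsHermitian) :
    M = conjDiag (hM.eigenvectorUnitary : Matrix n n ℂ) hM.eigenvalues := by
  conv_lhs => rw [hM.spectral_theorem, Unitary.conjStarAlgAut_apply]
  rfl

lemma exists_conjDiag {M : Matrix n n ℂ} (hM : M.PosSemidef) :
    ∃ U ∈ unitaryGroup n ℂ, ∃ d : n → ℝ, (∀ i, 0 ≤ d i) ∧ M = conjDiag U d :=
  ⟨_, hM.1.eigenvectorUnitary.2, _, hM.eigenvalues_nonneg, isHermitian_eq_conjDiag hM.1⟩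

lemma trace_mpow_conjDiag {U : Matrix n n ℂ} (hU : U ∈ unitaryGroup n ℂ) (d : n → ℝ) (p : ℝ) :
    (mpow (conjDiag U d) p).trace.re = ∑ i, d i ^ p := by
  rw [mpow_conjDiag hU, trace_conjDiag hU, Complex.ofReal_re]

/-- K Kᴴ and Kᴴ K have the same characteristic polynomial, hence the same ordered eigenvalues. -/
lemma trace_mpow_comm (K : Matrix n n ℂ) (p : ℝ) :
    (mpow (K * Kᴴ) p).trace.re = (mpow (Kᴴ * K) p).trace.re := by
  have h1 := (posSemidef_self_mul_conjTranspose K).1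
  have h2 := (posSemidef_conjTranspose_mul_self K).1
  have h : h1.eigenvalues = h2.eigenvalues :=
    (h1.eigenvalues_eq_eigenvalues_iff h2).mpr (charpoly_mul_comm _ _)
  conv_lhs => rw [isHermitian_eq_conjDiag h1]
  conv_rhs => rw [isHermitian_eq_conjDiag h2]
  rw [trace_mpow_conjDiag h1.eigenvectorUnitary.2, trace_mpow_conjDiag h2.eigenvectorUnitary.2, h]

lemma trace_mul_conjDiag (M W : Matrix n n ℂ) (g : n → ℝ) :
    (M * conjDiag W g).trace.re = ∑ k, diagEntry W M k * g k := by
  have : (M * conjDiag W g).trace = (Wᴴ * M * W * diagonal (fun i => (g i : ℂ))).trace := by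
    rw [conjDiag, ← Matrix.mul_assoc, trace_mul_comm]
    simp only [Matrix.mul_assoc]
  rw [this, trace, Complex.re_sum]
  simp [diagEntry, mul_diagonal]

/-- This is what turns operator traces into classical sums: all non-commutativity is absorbed into
the non-negative weights. -/
lemma diagEntry_sandwich (Y X W : Matrix n n ℂ) (f : n → ℝ) (k : n) :
    diagEntry W (Xᴴ * conjDiag Y f * X) k = ∑ i, weight Y X W i k * f i := by
  have : Wᴴ * (Xᴴ * conjDiag Y f * X) * W =
      (Yᴴ * X * W)ᴴ * (diagonal (fun i => (f i : ℂ)) * (Yᴴ * X * W)) := by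
    simp [conjDiag, Matrix.mul_assoc]
  rw [diagEntry, this, mul_apply, Complex.re_sum]
  refine Finset.sum_congr rfl fun i _ => ?_
  rw [diagonal_mul, conjTranspose_apply, weight, Complex.normSq_apply]
  simp
  ring

lemma diagEntry_conjDiag (Y W : Matrix n n ℂ) (f : n → ℝ) (k : n) :
    diagEntry W (conjDiag Y f) k = ∑ i, weight Y 1 W i k * f i := by
  simpa using diagEntry_sandwich Y 1 W f k

lemma diagEntry_conjDiag_self {W : Matrix n n ℂ} (hW : W ∈ unitaryGroup n ℂ) (f : n → ℝ) (k : n) :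
    diagEntry W (conjDiag W f) k = f k := by
  have h := conjTranspose_mul_self_of_unitary hW
  have : Wᴴ * conjDiag W f * W = diagonal (fun i => (f i : ℂ)) := by
    rw [conjDiag]
    calc _ = (Wᴴ * W) * diagonal (fun i => (f i : ℂ)) * (Wᴴ * W) := by
          simp only [Matrix.mul_assoc]
      _ = _ := by rw [h]; simp
  simp [diagEntry, this]

omit [DecidableEq n] in
lemma weight_nonneg (Y X W : Matrix n n ℂ) (i k : n) : 0 ≤ weight Y X W i k :=
  Complex.normSq_nonneg _

lemma sum_weight_left {Y : Matrix n n ℂ} (hY : Y ∈ unitaryGroup n ℂ) (X W : Matrix n n ℂ) (k : n) :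
    ∑ i, weight Y X W i k = diagEntry W (Xᴴ * X) k := by
  have := diagEntry_sandwich Y X W (fun _ => 1) k
  rw [conjDiag_one hY] at this
  simpa using this.symm

lemma sum_weight_one_left {Y W : Matrix n n ℂ} (hY : Y ∈ unitaryGroup n ℂ)
    (hW : W ∈ unitaryGroup n ℂ) (k : n) : ∑ i, weight Y 1 W i k = 1 := by
  rw [sum_weight_left hY]
  simp [diagEntry, conjTranspose_mul_self_of_unitary hW]

lemma weight_one_comm (Y W : Matrix n n ℂ) (i k : n) : weight Y 1 W i k = weight W 1 Y k i := by
  have : (Yᴴ * (1 : Matrix n n ℂ) * W : Matrix n n ℂ) i k =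
      star ((Wᴴ * (1 : Matrix n n ℂ) * Y : Matrix n n ℂ) k i) := by
    rw [← conjTranspose_apply, conjTranspose_mul, conjTranspose_mul]; simp
  rw [weight, this, weight]
  simp

lemma sum_weight_one_right {Y W : Matrix n n ℂ} (hY : Y ∈ unitaryGroup n ℂ)
    (hW : W ∈ unitaryGroup n ℂ) (i : n) : ∑ k, weight Y 1 W i k = 1 := by
  simp_rw [weight_one_comm Y W]
  exact sum_weight_one_left hW hY i

lemma sum_diagEntry {W : Matrix n n ℂ} (hW : W ∈ unitaryGroup n ℂ) (M : Matrix n n ℂ) :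
    ∑ k, diagEntry W M k = M.trace.re := by
  have := trace_mul_conjDiag M W (fun _ => 1)
  rw [conjDiag_one hW] at this
  simpa using this.symm

lemma kronecker_conjDiag (U : Matrix n n ℂ) (V : Matrix m m ℂ) (d : n → ℝ) (e : m → ℝ) :
    conjDiag U d ⊗ₖ conjDiag V e = conjDiag (U ⊗ₖ V) (fun i => d i.1 * e i.2) := by
  rw [conjDiag, conjDiag, conjDiag, mul_kronecker_mul, mul_kronecker_mul,
    diagonal_kronecker_diagonal, conjTranspose_kronecker]
  simp

lemma kronecker_mem_unitary {U : Matrix n n ℂ} {V : Matrix m m ℂ} (hU : U ∈ unitaryGroup n ℂ)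
    (hV : V ∈ unitaryGroup m ℂ) : U ⊗ₖ V ∈ unitaryGroup (n × m) ℂ := by
  rw [mem_unitaryGroup_iff, star_eq_conjTranspose, conjTranspose_kronecker, ← mul_kronecker_mul,
    mul_conjTranspose_self_of_unitary hU, mul_conjTranspose_self_of_unitary hV, one_kronecker_one]

end Diagonal

/-! ### Classical Hölder and Jensen inequalities for finite sums. -/

section Classical

variable {ι : Type*} [Fintype ι]

lemma sum_rpow_mul_rpow_le {f g : ι → ℝ} (hf : ∀ i, 0 ≤ f i) (hg : ∀ i, 0 ≤ g i) {θ : ℝ}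
    (h0 : 0 < θ) (h1 : θ < 1) :
    ∑ i, f i ^ θ * g i ^ (1 - θ) ≤ (∑ i, f i) ^ θ * (∑ i, g i) ^ (1 - θ) := by
  have hc : (1 / θ).HolderConjugate (1 / (1 - θ)) := by
    rw [Real.holderConjugate_iff]
    refine ⟨by rw [lt_div_iff₀ h0]; linarith, ?_⟩
    simp
  have h1' : 1 - θ ≠ 0 := by linarith
  have := Real.inner_le_Lp_mul_Lq_of_nonneg Finset.univ hc
    (f := fun i => f i ^ θ) (g := fun i => g i ^ (1 - θ))
    (fun i _ => Real.rpow_nonneg (hf i) _) (fun i _ => Real.rpow_nonneg (hg i) _)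
  refine this.trans_eq ?_
  have e1 : ∀ i, (f i ^ θ) ^ (1 / θ) = f i := fun i => by
    rw [← Real.rpow_mul (hf i), mul_one_div_cancel h0.ne', Real.rpow_one]
  have e2 : ∀ i, (g i ^ (1 - θ)) ^ (1 / (1 - θ)) = g i := fun i => by
    rw [← Real.rpow_mul (hg i), mul_one_div_cancel h1', Real.rpow_one]
  simp only [e1, e2, one_div_one_div]

lemma sum_mul_rpow_pos {P y : ι → ℝ} (hP : ∀ i, 0 ≤ P i) (hP1 : ∑ i, P i = 1)
    (hy : ∀ i, P i ≠ 0 → 0 < y i) (c : ℝ) : 0 < ∑ i, P i * y i ^ c := by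
  obtain ⟨i, _, hi⟩ := Finset.exists_ne_zero_of_sum_ne_zero (hP1.trans_ne one_ne_zero)
  refine Finset.sum_pos' (fun j _ => ?_) ⟨i, Finset.mem_univ _, ?_⟩
  · by_cases h : P j = 0
    · simp [h]
    · exact mul_nonneg (hP j) (Real.rpow_nonneg (hy j h).le _)
  · exact mul_pos (lt_of_le_of_ne (hP i) (Ne.symm hi)) (Real.rpow_pos_of_pos (hy i hi) _)

/-- Jensen's inequality for the logarithm of a power. -/
lemma mul_sum_logb_le {P y : ι → ℝ} (hP : ∀ i, 0 ≤ P i) (hP1 : ∑ i, P i = 1)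
    (hy : ∀ i, P i ≠ 0 → 0 < y i) (c : ℝ) :
    c * ∑ i, P i * Real.logb 2 (y i) ≤ Real.logb 2 (∑ i, P i * y i ^ c) := by
  have hpos := sum_mul_rpow_pos hP hP1 hy c
  set S := ∑ i, P i * y i ^ c with hS
  have key : ∑ i, P i * (c * Real.log (y i)) ≤ Real.log S := by
    -- This is log x ≤ x - 1 at x = y_i^c / S. After summation the bracket vanishes, because the P_i
    -- add up to 1.
    have h : ∀ i, P i * (c * Real.log (y i)) ≤ P i * Real.log S + (P i * y i ^ c / S - P i) := by
      intro i
      by_cases h : P i = 0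
      · simp [h]
      · have hyc := Real.rpow_pos_of_pos (hy i h) c
        have := Real.log_le_sub_one_of_pos (div_pos hyc hpos)
        rw [Real.log_div hyc.ne' hpos.ne', Real.log_rpow (hy i h)] at this
        have := mul_le_mul_of_nonneg_left this (hP i)
        have e : P i * y i ^ c / S = P i * (y i ^ c / S) := by ring
        rw [e]; linarith
    refine (Finset.sum_le_sum fun i _ => h i).trans_eq ?_
    rw [Finset.sum_add_distrib, Finset.sum_sub_distrib, ← Finset.sum_mul, ← Finset.sum_div, ← hS,
      div_self hpos.ne', hP1]
    ring
  have h2 : 0 < Real.log 2 := Real.log_pos (by norm_num)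
  have e : c * ∑ i, P i * Real.logb 2 (y i) = (∑ i, P i * (c * Real.log (y i))) / Real.log 2 := by
    rw [Finset.mul_sum, Finset.sum_div]
    refine Finset.sum_congr rfl fun i _ => ?_
    rw [Real.logb]; ring
  rw [e, Real.logb]
  exact div_le_div_of_nonneg_right key h2.le

lemma mul_log_le_mul_log_add {r w : ℝ} (hr : 0 ≤ r) (hw : 0 ≤ w) (h : w = 0 → r = 0) :
    r * Real.log w ≤ r * Real.log r + (w - r) := by
  rcases hr.eq_or_lt with hr0 | hr0
  · simp [← hr0, hw]
  · have hw0 : 0 < w := lt_of_le_of_ne hw fun h' => hr0.ne' (h h'.symm)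
    have := mul_le_mul_of_nonneg_left (Real.log_le_sub_one_of_pos (div_pos hw0 hr0)) hr
    rw [Real.log_div hw0.ne' hr0.ne'] at this
    have e : r * (w / r - 1) = w - r := by field_simp
    linarith

end Classical

/-! ### Variational formulas for Schatten quasi-norms and Klein's inequality. -/

section Variational

variable {n : Type*} [Fintype n] [DecidableEq n]

/-- The Schatten quasi-norm `(tr L^p)^(1/p)` of a positive semi-definite matrix. -/
noncomputable def schatten (p : ℝ) (L : Matrix n n ℂ) : ℝ := (mpow L p).trace.re ^ (1 / p)

lemma diagEntry_eq_zero_iff {V : Matrix n n ℂ} {l : n → ℝ} (hl : ∀ i, 0 ≤ l i) (W : Matrix n n ℂ)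
    (k : n) : diagEntry W (conjDiag V l) k = 0 ↔ ∀ j, weight V 1 W j k * l j = 0 := by
  rw [diagEntry_conjDiag, Finset.sum_eq_zero_iff_of_nonneg
    (fun j _ => mul_nonneg (weight_nonneg _ _ _ _ _) (hl j))]
  simp

lemma trace_mpow_pos {L : Matrix n n ℂ} (hL : L.PosSemidef) (h0 : L ≠ 0) (p : ℝ) :
    0 < (mpow L p).trace.re := by
  obtain ⟨V, hV, l, hl, rfl⟩ := exists_conjDiag hL
  rw [trace_mpow_conjDiag hV]
  have : ∃ i, l i ≠ 0 := by
    by_contra! h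
    exact h0 (by simp [conjDiag, h])
  obtain ⟨i, hi⟩ := this
  exact Finset.sum_pos' (fun j _ => Real.rpow_nonneg (hl j) _)
    ⟨i, Finset.mem_univ _, Real.rpow_pos_of_pos (lt_of_le_of_ne (hl i) (Ne.symm hi)) _⟩

lemma schatten_pos {L : Matrix n n ℂ} (hL : L.PosSemidef) (h0 : L ≠ 0) (p : ℝ) :
    0 < schatten p L := Real.rpow_pos_of_pos (trace_mpow_pos hL h0 p) _

/-- Hölder's inequality for the Schatten norm of order `p > 1`. -/
lemma sum_diagEntry_mul_le_schatten {L : Matrix n n ℂ} (hL : L.PosSemidef) {W : Matrix n n ℂ}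
    (hW : W ∈ unitaryGroup n ℂ) {w : n → ℝ} (hw : ∀ k, 0 ≤ w k) (hw1 : ∑ k, w k = 1)
    {p : ℝ} (hp : 1 < p) :
    ∑ k, diagEntry W L k * w k ^ ((p - 1) / p) ≤ schatten p L := by
  obtain ⟨V, hV, l, hl, rfl⟩ := exists_conjDiag hL
  have hp0 : 0 < p := by linarith
  have hp0' := hp0.ne'
  have hc := weight_nonneg V 1 W
  have h1p : 1 - 1 / p = (p - 1) / p := by field_simp
  -- The weights between two orthonormal bases are doubly stochastic. Hölder is applied to the pairs
  -- (j,k) with these weights, so that the two factors sum to tr L^p and to 1.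
  have key := sum_rpow_mul_rpow_le (ι := n × n) (f := fun x => weight V 1 W x.1 x.2 * l x.1 ^ p)
    (g := fun x => weight V 1 W x.1 x.2 * w x.2) (θ := 1 / p)
    (fun x => mul_nonneg (hc _ _) (Real.rpow_nonneg (hl _) _))
    (fun x => mul_nonneg (hc _ _) (hw _)) (by positivity) (by rw [div_lt_one hp0]; exact hp)
  rw [h1p] at key
  have e1 : ∀ x : n × n, (weight V 1 W x.1 x.2 * l x.1 ^ p) ^ (1 / p) *
      (weight V 1 W x.1 x.2 * w x.2) ^ ((p - 1) / p) =
      weight V 1 W x.1 x.2 * l x.1 * w x.2 ^ ((p - 1) / p) := by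
    intro x
    rw [Real.mul_rpow (hc _ _) (Real.rpow_nonneg (hl _) _), Real.mul_rpow (hc _ _) (hw _),
      ← Real.rpow_mul (hl _), mul_one_div_cancel hp0', Real.rpow_one]
    have : weight V 1 W x.1 x.2 ^ (1 / p) * weight V 1 W x.1 x.2 ^ ((p - 1) / p) =
        weight V 1 W x.1 x.2 := by
      rw [← Real.rpow_add' (hc _ _) (by rw [← h1p]; simp), ← h1p, add_sub_cancel, Real.rpow_one]
    linear_combination (l x.1 * w x.2 ^ ((p - 1) / p)) * this
  simp only [e1, Fintype.sum_prod_type] at key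
  have e2 : ∑ i, ∑ k, weight V 1 W i k * l i ^ p = ∑ i, l i ^ p := by
    simp_rw [← Finset.sum_mul, sum_weight_one_right hV hW, one_mul]
  have e3 : ∑ i, ∑ k, weight V 1 W i k * w k = 1 := by
    rw [Finset.sum_comm]
    simp_rw [← Finset.sum_mul, sum_weight_one_left hV hW, one_mul, hw1]
  rw [e2, e3, Real.one_rpow, mul_one, Finset.sum_comm] at key
  rw [schatten, trace_mpow_conjDiag hV]
  simpa only [diagEntry_conjDiag, Finset.sum_mul] using key

/-- The reverse Hölder inequality for the Schatten quasi-norm of order `p < 1`. -/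
lemma schatten_le_sum_diagEntry_mul {L : Matrix n n ℂ} (hL : L.PosSemidef) {W : Matrix n n ℂ}
    (hW : W ∈ unitaryGroup n ℂ) {w : n → ℝ} (hw : ∀ k, 0 ≤ w k) (hw1 : ∑ k, w k = 1)
    {p : ℝ} (hp0 : 0 < p) (hp : p < 1) (hker : ∀ k, w k = 0 → diagEntry W L k = 0) :
    schatten p L ≤ ∑ k, diagEntry W L k * w k ^ ((p - 1) / p) := by
  obtain ⟨V, hV, l, hl, rfl⟩ := exists_conjDiag hL
  have hp0' := hp0.ne'
  have hc := weight_nonneg V 1 W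
  have hT : ∀ x : n × n, 0 ≤ weight V 1 W x.1 x.2 * l x.1 * w x.2 ^ ((p - 1) / p) := fun x =>
    mul_nonneg (mul_nonneg (hc _ _) (hl _)) (Real.rpow_nonneg (hw _) _)
  -- The reverse inequality is Hölder with exponents p and 1-p, solved for the first factor: the
  -- product of the two terms is c·l^p, which sums to tr L^p.
  have key := sum_rpow_mul_rpow_le (ι := n × n)
    (f := fun x => weight V 1 W x.1 x.2 * l x.1 * w x.2 ^ ((p - 1) / p))
    (g := fun x => weight V 1 W x.1 x.2 * w x.2) (θ := p) hT
    (fun x => mul_nonneg (hc _ _) (hw _)) hp0 hp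
  have e1 : ∀ x : n × n, (weight V 1 W x.1 x.2 * l x.1 * w x.2 ^ ((p - 1) / p)) ^ p *
      (weight V 1 W x.1 x.2 * w x.2) ^ (1 - p) = weight V 1 W x.1 x.2 * l x.1 ^ p := by
    intro x
    -- Here the negative power of w is 0 by convention instead of infinite; the kernel hypothesis
    -- makes the right side vanish too.
    by_cases hwx : w x.2 = 0
    · rcases mul_eq_zero.mp ((diagEntry_eq_zero_iff hl W x.2).mp (hker _ hwx) x.1) with h | h <;>
        simp [h, Real.zero_rpow hp0']
    have hwx' : 0 < w x.2 := lt_of_le_of_ne (hw _) (Ne.symm hwx)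
    rw [Real.mul_rpow (mul_nonneg (hc _ _) (hl _)) (Real.rpow_nonneg (hw _) _),
      Real.mul_rpow (hc _ _) (hl _), Real.mul_rpow (hc _ _) (hw _),
      ← Real.rpow_mul (hw _), div_mul_cancel₀ _ hp0']
    have h1 : weight V 1 W x.1 x.2 ^ p * weight V 1 W x.1 x.2 ^ (1 - p) =
        weight V 1 W x.1 x.2 := by
      rw [← Real.rpow_add' (hc _ _) (by simp), add_sub_cancel, Real.rpow_one]
    have h2 : w x.2 ^ (p - 1) * w x.2 ^ (1 - p) = 1 := by
      rw [← Real.rpow_add hwx']; simp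
    linear_combination (l x.1 ^ p * w x.2 ^ (p - 1) * w x.2 ^ (1 - p)) * h1 +
      (l x.1 ^ p * weight V 1 W x.1 x.2) * h2
  simp only [e1, Fintype.sum_prod_type] at key
  have e2 : ∑ i, ∑ k, weight V 1 W i k * l i ^ p = ∑ i, l i ^ p := by
    simp_rw [← Finset.sum_mul, sum_weight_one_right hV hW, one_mul]
  have e3 : ∑ i, ∑ k, weight V 1 W i k * w k = 1 := by
    rw [Finset.sum_comm]
    simp_rw [← Finset.sum_mul, sum_weight_one_left hV hW, one_mul, hw1]
  rw [e2, e3, Real.one_rpow, mul_one, Finset.sum_comm] at key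
  rw [schatten, trace_mpow_conjDiag hV]
  simp only [diagEntry_conjDiag, Finset.sum_mul]
  refine (Real.rpow_le_rpow (Finset.sum_nonneg fun i _ => Real.rpow_nonneg (hl i) _) key
    (by positivity)).trans_eq ?_
  rw [← Real.rpow_mul (Finset.sum_nonneg fun k _ => Finset.sum_nonneg fun i _ => hT (i, k)),
    mul_one_div_cancel hp0', Real.rpow_one]

/-- Both Hölder inequalities are attained. -/
lemma exists_sum_diagEntry_mul_eq_schatten {L : Matrix n n ℂ} (hL : L.PosSemidef) (h0 : L ≠ 0)
    {p : ℝ} (hp0 : 0 < p) :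
    ∃ W ∈ unitaryGroup n ℂ, ∃ w : n → ℝ, (∀ k, 0 ≤ w k) ∧ ∑ k, w k = 1 ∧
      (∀ k, w k = 0 → diagEntry W L k = 0) ∧
      ∑ k, diagEntry W L k * w k ^ ((p - 1) / p) = schatten p L := by
  have hQ := trace_mpow_pos hL h0 p
  obtain ⟨V, hV, l, hl, rfl⟩ := exists_conjDiag hL
  rw [schatten]
  rw [trace_mpow_conjDiag hV] at hQ ⊢
  have hp0' := hp0.ne'
  set Q := ∑ i, l i ^ p with hQd
  have hlp : ∀ k, 0 ≤ l k ^ p := fun k => Real.rpow_nonneg (hl k) _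
  -- The optimiser is L^p / tr L^p, diagonal in the eigenbasis of L.
  refine ⟨V, hV, fun k => l k ^ p / Q, fun k => div_nonneg (hlp k) hQ.le, ?_, ?_, ?_⟩
  · rw [← Finset.sum_div, div_self hQ.ne']
  · intro k hk
    rw [diagEntry_conjDiag_self hV]
    rcases div_eq_zero_iff.mp hk with h | h
    · exact (Real.rpow_eq_zero (hl k) hp0').mp h
    · exact absurd h hQ.ne'
  · simp only [diagEntry_conjDiag_self hV]
    have e : ∀ k, l k * (l k ^ p / Q) ^ ((p - 1) / p) = l k ^ p * Q ^ (-((p - 1) / p)) := by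
      intro k
      rcases (hl k).eq_or_lt with h | h
      · simp [← h, Real.zero_rpow hp0']
      · rw [Real.div_rpow (hlp k) hQ.le, ← Real.rpow_mul (hl k), mul_div_cancel₀ _ hp0',
          Real.rpow_neg hQ.le, ← div_eq_mul_inv, ← mul_div_assoc]
        congr 1
        nth_rewrite 1 [← Real.rpow_one (l k)]
        rw [← Real.rpow_add h]; ring_nf
    simp only [e]
    rw [← Finset.sum_mul, ← hQd]
    nth_rewrite 1 [← Real.rpow_one Q]
    rw [← Real.rpow_add hQ]
    congr 1
    field_simp
    ring

/-- The non-negativity of the relative entropy, in diagonal form. -/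
lemma sum_diagEntry_mul_logb_le {V : Matrix n n ℂ} (hV : V ∈ unitaryGroup n ℂ) {r : n → ℝ}
    (hr : ∀ i, 0 ≤ r i) (hr1 : ∑ i, r i = 1) {W : Matrix n n ℂ}
    (hW : W ∈ unitaryGroup n ℂ) {w : n → ℝ} (hw : ∀ k, 0 ≤ w k) (hw1 : ∑ k, w k = 1)
    (hker : ∀ k, w k = 0 → diagEntry W (conjDiag V r) k = 0) :
    ∑ k, diagEntry W (conjDiag V r) k * Real.logb 2 (w k) ≤ ∑ i, r i * Real.logb 2 (r i) := by
  have hc := weight_nonneg V 1 W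
  have h2 : 0 < Real.log 2 := Real.log_pos (by norm_num)
  -- The pointwise bound r log w ≤ r log r + (w - r) is averaged over doubly stochastic weights; the
  -- linear terms cancel since r and w both sum to 1.
  have key : ∑ k, ∑ i, weight V 1 W i k * (r i * Real.log (w k)) ≤
      ∑ i, r i * Real.log (r i) := by
    calc _ ≤ ∑ k, ∑ i, weight V 1 W i k * (r i * Real.log (r i) + (w k - r i)) := by
          refine Finset.sum_le_sum fun k _ => Finset.sum_le_sum fun i _ => ?_
          rcases (hc i k).eq_or_lt with h | h
          · simp [← h]
          · refine mul_le_mul_of_nonneg_left (mul_log_le_mul_log_add (hr i) (hw k) fun h0 => ?_) h.le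
            exact (mul_eq_zero.mp ((diagEntry_eq_zero_iff hr W k).mp (hker k h0) i)).resolve_left
              h.ne'
      _ = ∑ i, ∑ k, weight V 1 W i k * (r i * Real.log (r i) - r i) +
            ∑ k, ∑ i, weight V 1 W i k * w k := by
          rw [Finset.sum_comm (f := fun i k => weight V 1 W i k * (r i * Real.log (r i) - r i)),
            ← Finset.sum_add_distrib]
          refine Finset.sum_congr rfl fun k _ => ?_
          rw [← Finset.sum_add_distrib]
          exact Finset.sum_congr rfl fun i _ => by ring
      _ = _ := by
          simp_rw [← Finset.sum_mul, sum_weight_one_left hV hW, sum_weight_one_right hV hW, one_mul,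
            Finset.sum_sub_distrib]
          rw [hr1, hw1]; ring
  have e1 : ∑ k, diagEntry W (conjDiag V r) k * Real.logb 2 (w k) =
      (∑ k, ∑ i, weight V 1 W i k * (r i * Real.log (w k))) / Real.log 2 := by
    simp only [diagEntry_conjDiag, Finset.sum_mul, Finset.sum_div, Real.logb]
    exact Finset.sum_congr rfl fun k _ => Finset.sum_congr rfl fun i _ => by ring
  have e2 : ∑ i, r i * Real.logb 2 (r i) = (∑ i, r i * Real.log (r i)) / Real.log 2 := by
    simp only [Finset.sum_div, Real.logb]
    exact Finset.sum_congr rfl fun k _ => by ring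
  rw [e1, e2]
  exact div_le_div_of_nonneg_right key h2.le

end Variational

/-! ### The sandwiched divergence as a Schatten norm, and its finiteness in terms of weights. -/

section Divergence

variable {n : Type*} [Fintype n] [DecidableEq n]

/-- `(p - 1) / p`, the reciprocal of the Hölder conjugate of `p`. -/
noncomputable def hat (p : ℝ) : ℝ := (p - 1) / p

lemma hat_pos {p : ℝ} (hp : 1 < p) : 0 < hat p := div_pos (by linarith) (by linarith)

lemma hat_neg {p : ℝ} (h0 : 0 < p) (hp : p < 1) : hat p < 0 := div_neg_of_neg_of_pos (by linarith) h0

lemma hat_ne_zero {p : ℝ} (h0 : 0 < p) (hp : p ≠ 1) : hat p ≠ 0 :=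
  div_ne_zero (sub_ne_zero.mpr hp) h0.ne'

lemma one_div_hat (p : ℝ) : 1 / hat p = p / (p - 1) := by rw [hat, one_div_div]

/-- The operator `Xᴴ κ^(-(p-1)/p) X` for `κ = Y diag(d) Yᴴ`. -/
noncomputable def compressed (p : ℝ) (Y X : Matrix n n ℂ) (d : n → ℝ) : Matrix n n ℂ :=
  Xᴴ * conjDiag Y (fun i => d i ^ (-hat p)) * X

/-- The sum `∑ P d^(-e) w^e` over the weights of `X`. -/
noncomputable def moment (Y X W : Matrix n n ℂ) (d w : n → ℝ) (e : ℝ) : ℝ :=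
  ∑ z : n × n, weight Y X W z.1 z.2 * (d z.1 ^ (-e) * w z.2 ^ e)

lemma compressed_posSemidef (p : ℝ) (Y X : Matrix n n ℂ) {d : n → ℝ} (hd : ∀ i, 0 ≤ d i) :
    (compressed p Y X d).PosSemidef :=
  (conjDiag_posSemidef Y fun i => Real.rpow_nonneg (hd i) _).conjTranspose_mul_mul_same X

lemma diagEntry_compressed (p : ℝ) (Y X W : Matrix n n ℂ) (d : n → ℝ) (k : n) :
    diagEntry W (compressed p Y X d) k = ∑ i, weight Y X W i k * d i ^ (-hat p) :=
  diagEntry_sandwich _ _ _ _ _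

lemma sum_diagEntry_compressed (p : ℝ) (Y X W : Matrix n n ℂ) (d w : n → ℝ) :
    ∑ k, diagEntry W (compressed p Y X d) k * w k ^ hat p = moment Y X W d w (hat p) := by
  rw [moment, Fintype.sum_prod_type, Finset.sum_comm]
  refine Finset.sum_congr rfl fun k _ => ?_
  rw [diagEntry_compressed, Finset.sum_mul]
  exact Finset.sum_congr rfl fun i _ => by ring

lemma schatten_le_moment {Y X W : Matrix n n ℂ} {d w : n → ℝ} (hd : ∀ i, 0 ≤ d i)
    (hW : W ∈ unitaryGroup n ℂ) (hw : ∀ k, 0 ≤ w k) (hw1 : ∑ k, w k = 1) {p : ℝ} (hp0 : 0 < p)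
    (hp : p < 1) (hker : ∀ i k, w k = 0 → weight Y X W i k = 0 ∨ d i = 0) :
    schatten p (compressed p Y X d) ≤ moment Y X W d w (hat p) := by
  rw [← sum_diagEntry_compressed]
  refine schatten_le_sum_diagEntry_mul (compressed_posSemidef p Y X hd) hW hw hw1 hp0 hp
    fun k hk => ?_
  rw [diagEntry_compressed]
  refine Finset.sum_eq_zero fun i _ => ?_
  rcases hker i k hk with h | h
  · simp [h]
  · simp [h, Real.zero_rpow (neg_ne_zero.mpr (hat_neg hp0 hp).ne)]

/-- The kernel condition of the optimiser can be read term by term, because a diagonal entry of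
`compressed` is a sum of non-negative terms. -/
lemma exists_moment_eq_schatten {Y X : Matrix n n ℂ} {d : n → ℝ} (hd : ∀ i, 0 ≤ d i) {p : ℝ}
    (hp0 : 0 < p) (h0 : compressed p Y X d ≠ 0) :
    ∃ W ∈ unitaryGroup n ℂ, ∃ w : n → ℝ, (∀ k, 0 ≤ w k) ∧ ∑ k, w k = 1 ∧
      (∀ i k, w k = 0 → weight Y X W i k = 0 ∨ d i = 0) ∧
      moment Y X W d w (hat p) = schatten p (compressed p Y X d) := by
  obtain ⟨W, hW, w, hw, hw1, hker, heq⟩ :=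
    exists_sum_diagEntry_mul_eq_schatten (compressed_posSemidef p Y X hd) h0 hp0
  refine ⟨W, hW, w, hw, hw1, fun i k hk => ?_, ?_⟩
  · have h := hker k hk
    rw [diagEntry_compressed, Finset.sum_eq_zero_iff_of_nonneg
      (fun j _ => mul_nonneg (weight_nonneg _ _ _ _ _) (Real.rpow_nonneg (hd j) _))] at h
    rcases mul_eq_zero.mp (h i (Finset.mem_univ _)) with h | h
    · exact Or.inl h
    · refine Or.inr ?_
      by_contra hne
      exact (Real.rpow_pos_of_pos (lt_of_le_of_ne (hd i) (Ne.symm hne)) _).ne' h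
  · rw [← sum_diagEntry_compressed]; exact heq

/-- The right basis `W` is arbitrary, so support conditions can be tested in whichever basis is
optimal later. -/
lemma conjTranspose_mul_conjDiag_eq_zero_iff {Y W : Matrix n n ℂ} (hY : Y ∈ unitaryGroup n ℂ)
    (hW : W ∈ unitaryGroup n ℂ) (X : Matrix n n ℂ) (f : n → ℝ) :
    Xᴴ * conjDiag Y f = 0 ↔ ∀ i k, f i ≠ 0 → weight Y X W i k = 0 := by
  have h1 : Xᴴ * conjDiag Y f = 0 ↔ diagonal (fun i => (f i : ℂ)) * (Yᴴ * X * W) = 0 := by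
    rw [← conjTranspose_eq_zero, conjTranspose_mul, conjDiag_conjTranspose,
      conjTranspose_conjTranspose, conjDiag]
    constructor
    · intro h
      have : Yᴴ * (Y * diagonal (fun i => (f i : ℂ)) * Yᴴ * X) * W = 0 := by rw [h]; simp
      calc _ = (Yᴴ * Y) * diagonal (fun i => (f i : ℂ)) * (Yᴴ * X * W) := by
            rw [conjTranspose_mul_self_of_unitary hY, Matrix.one_mul]
        _ = 0 := by rw [← this]; simp only [Matrix.mul_assoc]
    · intro h
      have : Y * (diagonal (fun i => (f i : ℂ)) * (Yᴴ * X * W)) * Wᴴ = 0 := by rw [h]; simp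
      calc _ = Y * diagonal (fun i => (f i : ℂ)) * Yᴴ * X * (W * Wᴴ) := by
            rw [mul_conjTranspose_self_of_unitary hW, Matrix.mul_one]
        _ = 0 := by rw [← this]; simp only [Matrix.mul_assoc]
  rw [h1]
  constructor
  · intro h i k hf
    have := congrFun (congrFun h i) k
    rw [diagonal_mul] at this
    rw [weight, Complex.normSq_eq_zero]
    exact (mul_eq_zero.mp this).resolve_left (by exact_mod_cast hf)
  · intro h
    ext i k
    rw [diagonal_mul]
    by_cases hf : f i = 0
    · simp [hf]
    · have := h i k hf
      rw [weight, Complex.normSq_eq_zero] at this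
      simp [this]

lemma orthogonal_iff {ρ X Y W : Matrix n n ℂ} (hX : X * Xᴴ = ρ) (hY : Y ∈ unitaryGroup n ℂ)
    (hW : W ∈ unitaryGroup n ℂ) (d : n → ℝ) :
    Orthogonal ρ (conjDiag Y d) ↔ ∀ i k, d i ≠ 0 → weight Y X W i k = 0 := by
  rw [← conjTranspose_mul_conjDiag_eq_zero_iff hY hW, Orthogonal, ← hX,
    self_mul_conjTranspose_mul_eq_zero]

lemma dominates_iff {ρ X Y W : Matrix n n ℂ} (hX : X * Xᴴ = ρ) (hY : Y ∈ unitaryGroup n ℂ)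
    (hW : W ∈ unitaryGroup n ℂ) (d : n → ℝ) :
    Dominates (conjDiag Y d) ρ ↔ ∀ i k, d i = 0 → weight Y X W i k = 0 := by
  have h1 := conjTranspose_mul_conjDiag_eq_zero_iff hY hW X (fun i => if d i = 0 then 1 else 0)
  -- `E` is the projection onto the kernel of κ; domination amounts to Xᴴ E = 0.
  set E := conjDiag Y (fun i => if d i = 0 then 1 else 0) with hE
  have h2 : (∀ i k, (if d i = 0 then (1 : ℝ) else 0) ≠ 0 → weight Y X W i k = 0) ↔
      ∀ i k, d i = 0 → weight Y X W i k = 0 := by simp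
  rw [← h2, ← h1]
  constructor
  · intro h
    rw [← self_mul_conjTranspose_mul_eq_zero, hX]
    have hdE : conjDiag Y d * E = 0 := by
      have e : (fun i => d i * if d i = 0 then 1 else 0) = fun _ => 0 := by
        ext i; split_ifs with hi <;> simp [hi]
      rw [hE, conjDiag_mul hY, e]; simp [conjDiag]
    ext i j
    have := h (fun l => E l j) (by ext l; exact congrFun (congrFun hdE l) j)
    exact congrFun this i
  · intro h v hv
    -- With the pseudoinverse, 1 = E + κ⁻¹κ, so E fixes every vector of the kernel of κ.
    have hsum : E + conjDiag Y (fun i => (d i)⁻¹) * conjDiag Y d = 1 := by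
      rw [hE, conjDiag_mul hY, conjDiag_add, ← conjDiag_one hY]
      congr 1; ext i; by_cases hi : d i = 0 <;> simp [hi]
    have hEv : E *ᵥ v = v := by
      have := congrArg (· *ᵥ v) hsum
      simpa [add_mulVec, ← mulVec_mulVec, hv] using this
    rw [← hEv, ← hX, mulVec_mulVec, Matrix.mul_assoc, h]
    simp

lemma sum_weight {X Y W : Matrix n n ℂ} (hY : Y ∈ unitaryGroup n ℂ) (hW : W ∈ unitaryGroup n ℂ) :
    ∑ z : n × n, weight Y X W z.1 z.2 = (X * Xᴴ).trace.re := by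
  rw [Fintype.sum_prod_type, Finset.sum_comm]
  simp_rw [sum_weight_left hY, sum_diagEntry hW]
  rw [trace_mul_comm]

/-- The weights have total mass 1, so they cannot vanish both where d = 0 and where d ≠ 0. -/
lemma not_orthogonal_of_dominates {ρ X Y : Matrix n n ℂ} (hρ : IsDensity ρ) (hX : X * Xᴴ = ρ)
    (hY : Y ∈ unitaryGroup n ℂ) {d : n → ℝ} (h : Dominates (conjDiag Y d) ρ) :
    ¬ Orthogonal ρ (conjDiag Y d) := by
  intro ho
  rw [dominates_iff hX hY hY] at h
  rw [orthogonal_iff hX hY hY] at ho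
  have hs := sum_weight (X := X) hY hY
  rw [hX, hρ.2, Finset.sum_eq_zero fun z _ => ?_] at hs
  · simp at hs
  · by_cases hz : d z.1 = 0
    · exact h _ _ hz
    · exact ho _ _ hz

lemma compressed_ne_zero {ρ X Y : Matrix n n ℂ} (hX : X * Xᴴ = ρ) (hY : Y ∈ unitaryGroup n ℂ)
    {d : n → ℝ} (hd : ∀ i, 0 ≤ d i) (h : ¬ Orthogonal ρ (conjDiag Y d)) (p : ℝ) :
    compressed p Y X d ≠ 0 := by
  intro h0
  apply h
  rw [orthogonal_iff hX hY hY]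
  intro i k hi
  have h1 := diagEntry_compressed p Y X Y d k
  rw [h0, eq_comm] at h1
  have h2 : diagEntry Y 0 k = 0 := by simp [diagEntry]
  rw [h2, Finset.sum_eq_zero_iff_of_nonneg
      (fun j _ => mul_nonneg (weight_nonneg _ _ _ _ _) (Real.rpow_nonneg (hd j) _))] at h1
  exact (mul_eq_zero.mp (h1 i (Finset.mem_univ _))).resolve_right
    (Real.rpow_pos_of_pos (lt_of_le_of_ne (hd i) (Ne.symm hi)) _).ne'

/-- With S = κ^(-p̂/2), the sandwiched operator is (SX)(SX)ᴴ and the compressed one is (SX)ᴴ(SX). -/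
lemma sandwichedTrace_conjDiag {ρ X Y : Matrix n n ℂ} (hX : X * Xᴴ = ρ)
    (hY : Y ∈ unitaryGroup n ℂ) {d : n → ℝ} (hd : ∀ i, 0 ≤ d i) {p : ℝ} (hp0 : 0 < p)
    (hp1 : p ≠ 1) :
    sandwichedTrace p ρ (conjDiag Y d) = (mpow (compressed p Y X d) p).trace.re := by
  rw [sandwichedTrace, mpow_conjDiag hY]
  set S := conjDiag Y (fun i => d i ^ ((1 - p) / (2 * p))) with hS
  have hSS : Sᴴ = S := conjDiag_conjTranspose _ _
  have e1 : S * ρ * S = (S * X) * (S * X)ᴴ := by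
    rw [conjTranspose_mul, hSS, ← hX]; simp only [Matrix.mul_assoc]
  have e2 : compressed p Y X d = (S * X)ᴴ * (S * X) := by
    have : conjDiag Y (fun i => d i ^ (-hat p)) = S * S := by
      rw [hS, conjDiag_mul hY]
      congr 1; ext i
      have hs : (1 - p) / (2 * p) + (1 - p) / (2 * p) = -hat p := by rw [hat]; field_simp; ring
      rw [← Real.rpow_add' (hd i) (hs ▸ neg_ne_zero.mpr (hat_ne_zero hp0 hp1)), hs]
    rw [compressed, this, conjTranspose_mul, hSS]; simp only [Matrix.mul_assoc]
  rw [e1, e2, trace_mpow_comm]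

lemma sandwichedDiv_conjDiag {ρ X Y : Matrix n n ℂ} (hX : X * Xᴴ = ρ)
    (hY : Y ∈ unitaryGroup n ℂ) {d : n → ℝ} (hd : ∀ i, 0 ≤ d i) {p : ℝ} (hp0 : 0 < p)
    (hp1 : p ≠ 1)
    (h : ¬ Orthogonal ρ (conjDiag Y d) ∧ (Dominates (conjDiag Y d) ρ ∨ p < 1)) :
    sandwichedDiv p ρ (conjDiag Y d) =
      ((1 / hat p * Real.logb 2 (schatten p (compressed p Y X d)) : ℝ) : EReal) := by
  rw [sandwichedDiv, if_pos h, sandwichedTrace_conjDiag hX hY hd hp0 hp1, schatten,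
    Real.logb_rpow_eq_mul_logb_of_pos (trace_mpow_pos (compressed_posSemidef p Y X hd)
      (compressed_ne_zero hX hY hd h.1 p) p), one_div_hat]
  congr 1
  have : p - 1 ≠ 0 := sub_ne_zero.mpr hp1
  have := hp0.ne'
  field_simp

lemma renyiEntropy_eq {ρ : Matrix n n ℂ} (hρ : ρ.PosSemidef) (h0 : ρ ≠ 0) {p : ℝ} (hp0 : 0 < p)
    (hp1 : p ≠ 1) : renyiEntropy p ρ = -(1 / hat p * Real.logb 2 (schatten p ρ)) := by
  rw [renyiEntropy, if_neg hp1, schatten, Real.logb_rpow_eq_mul_logb_of_pos (trace_mpow_pos hρ h0 p),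
    one_div_hat]
  have : p - 1 ≠ 0 := sub_ne_zero.mpr hp1
  have : 1 - p ≠ 0 := sub_ne_zero.mpr (Ne.symm hp1)
  have := hp0.ne'
  have e : (1 : ℝ) - p = -(p - 1) := by ring
  rw [e]
  field_simp

/-- The Hermitian square root is taken so that both marginals of the weights are diagonals of ρ; the
second identity matters for the comparison with the relative entropy. -/
lemma sqrt_mul_conjTranspose {ρ : Matrix n n ℂ} (hρ : ρ.PosSemidef) :
    ∃ X : Matrix n n ℂ, X * Xᴴ = ρ ∧ Xᴴ * X = ρ := by
  obtain ⟨V, hV, r, hr, rfl⟩ := exists_conjDiag hρ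
  refine ⟨conjDiag V (fun i => √(r i)), ?_, ?_⟩ <;>
  · rw [conjDiag_conjTranspose, conjDiag_mul hV]
    simp [Real.mul_self_sqrt (hr _)]

end Divergence

/-! ### Weights in a product basis and the reduced state. -/

section Bipartite

variable {A B : Type*} [Fintype A] [DecidableEq A] [Fintype B] [DecidableEq B]

omit [DecidableEq B] in
lemma trace_mul_one_kronecker (ρ : Matrix (A × B) (A × B) ℂ) (G : Matrix B B ℂ) :
    (ρ * ((1 : Matrix A A ℂ) ⊗ₖ G)).trace = (reducedRight ρ * G).trace := by
  simp only [trace, diag_apply, mul_apply, reducedRight, kroneckerMap_apply, of_apply,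
    Fintype.sum_prod_type, Finset.sum_mul, one_apply]
  rw [Finset.sum_comm]
  refine Finset.sum_congr rfl fun j _ => ?_
  rw [Finset.sum_comm (γ := B)]
  refine Finset.sum_congr rfl fun i _ => ?_
  rw [Finset.sum_comm]
  simp

lemma reducedRight_isDensity {ρ : Matrix (A × B) (A × B) ℂ} (hρ : IsDensity ρ) :
    IsDensity (reducedRight ρ) := by
  constructor
  · have : reducedRight ρ = ∑ i : A, ρ.submatrix (fun j => (i, j)) (fun j => (i, j)) := by
      ext j j'; simp [reducedRight, Matrix.sum_apply]
    rw [this]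
    exact posSemidef_sum _ fun i _ => hρ.1.submatrix _
  · have := trace_mul_one_kronecker ρ 1
    rw [one_kronecker_one, Matrix.mul_one, Matrix.mul_one] at this
    rw [← this, hρ.2]

lemma IsDensity.ne_zero {n : Type*} [Fintype n] {ρ : Matrix n n ℂ} (hρ : IsDensity ρ) : ρ ≠ 0 := by
  rintro rfl
  simpa using hρ.2

/-- The marginal of the weights on the `B`-index of the left basis is the diagonal of ρ_B in the
basis `V`, whatever `W` is. -/
lemma sum_weight_kronecker {U : Matrix A A ℂ} (hU : U ∈ unitaryGroup A ℂ) (V : Matrix B B ℂ)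
    {ρ X W : Matrix (A × B) (A × B) ℂ} (hX : X * Xᴴ = ρ) (hW : W ∈ unitaryGroup (A × B) ℂ)
    (g : B → ℝ) :
    ∑ z : (A × B) × (A × B), weight (U ⊗ₖ V) X W z.1 z.2 * g z.1.2 =
      ∑ j, diagEntry V (reducedRight ρ) j * g j := by
  rw [← trace_mul_conjDiag, ← trace_mul_one_kronecker, ← conjDiag_one hU, kronecker_conjDiag,
    Fintype.sum_prod_type, Finset.sum_comm]
  simp only [one_mul]
  have : ∀ k, ∑ x, weight (U ⊗ₖ V) X W x k * g x.2 =
      diagEntry W (Xᴴ * conjDiag (U ⊗ₖ V) (fun x => g x.2) * X) k := fun k =>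
    (diagEntry_sandwich _ _ _ _ _).symm
  simp_rw [this]
  rw [sum_diagEntry hW, ← hX, Matrix.mul_assoc, trace_mul_comm Xᴴ, trace_mul_comm (X * Xᴴ),
    Matrix.mul_assoc]

lemma diagEntry_reducedRight_eq_zero {U : Matrix A A ℂ} (hU : U ∈ unitaryGroup A ℂ)
    {V : Matrix B B ℂ} {ρ X W : Matrix (A × B) (A × B) ℂ} (hX : X * Xᴴ = ρ)
    (hW : W ∈ unitaryGroup (A × B) ℂ) {j : B} (h : ∀ i k, weight (U ⊗ₖ V) X W (i, j) k = 0) :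
    diagEntry V (reducedRight ρ) j = 0 := by
  -- Testing against the indicator of `j` shows that the entry of ρ_B is the sum of all weights with
  -- that `B`-index.
  have := sum_weight_kronecker hU V hX hW (fun j' => if j' = j then 1 else 0)
  simp only [mul_ite, mul_one, mul_zero, Finset.sum_ite_eq', Finset.mem_univ, if_true] at this
  rw [← this]
  refine Finset.sum_eq_zero fun z _ => ?_
  obtain ⟨⟨i, j'⟩, k⟩ := z
  split_ifs with hj
  · cases hj; exact h i k
  · rfl

lemma weight_eq_zero_of_diagEntry_reducedRight {U : Matrix A A ℂ} (hU : U ∈ unitaryGroup A ℂ)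
    {V : Matrix B B ℂ} {ρ X W : Matrix (A × B) (A × B) ℂ} (hX : X * Xᴴ = ρ)
    (hW : W ∈ unitaryGroup (A × B) ℂ) {j : B} (h : diagEntry V (reducedRight ρ) j = 0) (i : A)
    (k : A × B) : weight (U ⊗ₖ V) X W (i, j) k = 0 := by
  have := sum_weight_kronecker hU V hX hW (fun j' => if j' = j then 1 else 0)
  simp only [mul_ite, mul_one, mul_zero, Finset.sum_ite_eq', Finset.mem_univ, if_true, h] at this
  rw [Finset.sum_eq_zero_iff_of_nonneg] at this
  · simpa using this ((i, j), k) (Finset.mem_univ _)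
  · intro z _
    split_ifs
    · exact weight_nonneg _ _ _ _ _
    · exact le_rfl

end Bipartite

/-! ### The three forms of Hölder's inequality for the factorisation w/t = (w/(ts))·s. -/

section Holder

variable {ι : Type*} [Fintype ι]

/-- Positivity of the mixed sum forces both factors to be positive, so no logarithm takes its
default value at 0. -/
lemma logb_sum_le {P F G T : ι → ℝ} (hP : ∀ i, 0 ≤ P i) (hF : ∀ i, 0 ≤ F i) (hG : ∀ i, 0 ≤ G i)
    {θ η : ℝ} (h0 : 0 < θ) (h1 : 0 < η) (hθ : θ + η = 1)
    (hT : ∀ i, P i ≠ 0 → F i ^ θ * G i ^ η = T i) (hpos : 0 < ∑ i, P i * T i) :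
    0 < ∑ i, P i * F i ∧ 0 < ∑ i, P i * G i ∧ Real.logb 2 (∑ i, P i * T i) ≤
      θ * Real.logb 2 (∑ i, P i * F i) + η * Real.logb 2 (∑ i, P i * G i) := by
  obtain rfl : η = 1 - θ := by linarith
  have key := sum_rpow_mul_rpow_le (fun i => mul_nonneg (hP i) (hF i))
    (fun i => mul_nonneg (hP i) (hG i)) h0 (by linarith)
  have e : ∀ i, (P i * F i) ^ θ * (P i * G i) ^ (1 - θ) = P i * T i := by
    intro i
    by_cases h : P i = 0
    · simp [h, Real.zero_rpow h0.ne']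
    · rw [Real.mul_rpow (hP i) (hF i), Real.mul_rpow (hP i) (hG i), ← hT i h]
      have : P i ^ θ * P i ^ (1 - θ) = P i := by
        rw [← Real.rpow_add' (hP i) (by simp), add_sub_cancel, Real.rpow_one]
      linear_combination (F i ^ θ * G i ^ (1 - θ)) * this
  simp only [e] at key
  have hf := Finset.sum_nonneg fun i (_ : i ∈ Finset.univ) => mul_nonneg (hP i) (hF i)
  have hg := Finset.sum_nonneg fun i (_ : i ∈ Finset.univ) => mul_nonneg (hP i) (hG i)
  have hf' : 0 < ∑ i, P i * F i := by
    refine lt_of_le_of_ne hf fun h => ?_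
    rw [← h, Real.zero_rpow h0.ne', zero_mul] at key
    linarith
  have hg' : 0 < ∑ i, P i * G i := by
    refine lt_of_le_of_ne hg fun h => ?_
    rw [← h, Real.zero_rpow h1.ne', mul_zero] at key
    linarith
  refine ⟨hf', hg', ?_⟩
  rw [← Real.logb_rpow_eq_mul_logb_of_pos hf', ← Real.logb_rpow_eq_mul_logb_of_pos hg',
    ← Real.logb_mul (Real.rpow_pos_of_pos hf' _).ne' (Real.rpow_pos_of_pos hg' _).ne']
  exact Real.logb_le_logb_of_le (by norm_num) hpos key

variable {P t s w : ι → ℝ} {a b g : ℝ}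

/-- The quantity whose sign is decided by Hölder's inequality for `U = w / t` and `S = s`, the
exponents being related by `1 / a = 1 / b + 1 / g`. -/
noncomputable def holderGap (P t s w : ι → ℝ) (a b g : ℝ) : ℝ :=
  1 / b * Real.logb 2 (∑ i, P i * ((t i * s i) ^ (-b) * w i ^ b)) +
    1 / g * Real.logb 2 (∑ i, P i * s i ^ g) -
    1 / a * Real.logb 2 (∑ i, P i * (t i ^ (-a) * w i ^ a))

/-- The mixed term is (w/t)^a = ((w/(ts))^b)^(a/b) · (s^g)^(a/g). This form applies when a, b, g
have the same sign. -/
lemma holder_quotient (hP : ∀ i, 0 ≤ P i) (ht : ∀ i, 0 ≤ t i) (hs : ∀ i, 0 ≤ s i)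
    (hw : ∀ i, 0 ≤ w i) (ha : a ≠ 0) (hb : b ≠ 0) (hg : g ≠ 0) (hrel : 1 / a = 1 / b + 1 / g)
    (hab : 0 < a / b) (hag : 0 < a / g) (hs' : ∀ i, P i ≠ 0 → s i ≠ 0)
    (hpos : 0 < ∑ i, P i * (t i ^ (-a) * w i ^ a)) :
    0 < ∑ i, P i * ((t i * s i) ^ (-b) * w i ^ b) ∧ 0 < ∑ i, P i * s i ^ g ∧
      0 ≤ a * holderGap P t s w a b g := by
  obtain ⟨h1, h2, h3⟩ := logb_sum_le (P := P) (F := fun i => (t i * s i) ^ (-b) * w i ^ b)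
    (G := fun i => s i ^ g) (T := fun i => t i ^ (-a) * w i ^ a) hP
    (fun i => mul_nonneg (Real.rpow_nonneg (mul_nonneg (ht i) (hs i)) _)
      (Real.rpow_nonneg (hw i) _)) (fun i => Real.rpow_nonneg (hs i) _) hab hag
    (by
      have : a / b + a / g = a * (1 / b + 1 / g) := by ring
      rw [this, ← hrel]; field_simp)
    (fun i hi => by
      have hsi : 0 < s i := lt_of_le_of_ne (hs i) (Ne.symm (hs' i hi))
      rw [Real.mul_rpow (Real.rpow_nonneg (mul_nonneg (ht i) (hs i)) _) (Real.rpow_nonneg (hw i) _),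
        Real.mul_rpow (ht i) (hs i),
        Real.mul_rpow (Real.rpow_nonneg (ht i) _) (Real.rpow_nonneg (hs i) _),
        ← Real.rpow_mul (ht i), ← Real.rpow_mul (hs i), ← Real.rpow_mul (hs i),
        ← Real.rpow_mul (hw i), mul_div_cancel₀ _ hb, neg_mul, mul_div_cancel₀ _ hb,
        mul_div_cancel₀ _ hg]
      have : s i ^ (-a) * s i ^ a = 1 := by rw [← Real.rpow_add hsi]; simp
      linear_combination (t i ^ (-a) * w i ^ a) * this) hpos
  refine ⟨h1, h2, ?_⟩
  rw [holderGap, mul_sub, mul_add, ← mul_assoc, ← mul_assoc, ← mul_assoc, mul_one_div_cancel ha,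
    mul_one_div, mul_one_div]
  linarith

/-- Solving the factorisation for s, the mixed term is s^g = ((w/t)^a)^(g/a) · ((w/(ts))^b)^(-g/b).
It applies when b has the sign opposite to a and g; cancelling t and w requires both to be non-zero
wherever P is. -/
lemma holder_left (hP : ∀ i, 0 ≤ P i) (ht : ∀ i, 0 ≤ t i) (hs : ∀ i, 0 ≤ s i)
    (hw : ∀ i, 0 ≤ w i) (ha : a ≠ 0) (hb : b ≠ 0) (hg : g ≠ 0) (hrel : 1 / a = 1 / b + 1 / g)
    (hga : 0 < g / a) (hgb : 0 < -g / b) (ht' : ∀ i, P i ≠ 0 → t i ≠ 0)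
    (hw' : ∀ i, P i ≠ 0 → w i ≠ 0) (hpos : 0 < ∑ i, P i * s i ^ g) :
    0 < ∑ i, P i * (t i ^ (-a) * w i ^ a) ∧ 0 < ∑ i, P i * ((t i * s i) ^ (-b) * w i ^ b) ∧
      0 ≤ -g * holderGap P t s w a b g := by
  obtain ⟨h1, h2, h3⟩ := logb_sum_le (P := P) (F := fun i => t i ^ (-a) * w i ^ a)
    (G := fun i => (t i * s i) ^ (-b) * w i ^ b) (T := fun i => s i ^ g) hP
    (fun i => mul_nonneg (Real.rpow_nonneg (ht i) _) (Real.rpow_nonneg (hw i) _))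
    (fun i => mul_nonneg (Real.rpow_nonneg (mul_nonneg (ht i) (hs i)) _)
      (Real.rpow_nonneg (hw i) _)) hga hgb
    (by rw [div_eq_mul_one_div g a, hrel]; field_simp; ring)
    (fun i hi => by
      have hti : 0 < t i := lt_of_le_of_ne (ht i) (Ne.symm (ht' i hi))
      have hwi : 0 < w i := lt_of_le_of_ne (hw i) (Ne.symm (hw' i hi))
      rw [Real.mul_rpow (Real.rpow_nonneg (mul_nonneg (ht i) (hs i)) _) (Real.rpow_nonneg (hw i) _),
        Real.mul_rpow (ht i) (hs i),
        Real.mul_rpow (Real.rpow_nonneg (ht i) _) (Real.rpow_nonneg (hs i) _),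
        Real.mul_rpow (Real.rpow_nonneg (ht i) _) (Real.rpow_nonneg (hw i) _),
        ← Real.rpow_mul (ht i), ← Real.rpow_mul (ht i), ← Real.rpow_mul (hs i),
        ← Real.rpow_mul (hw i), ← Real.rpow_mul (hw i)]
      have e1 : -a * (g / a) = -g := by field_simp
      have e2 : a * (g / a) = g := by field_simp
      have e3 : -b * (-g / b) = g := by field_simp
      have e4 : b * (-g / b) = -g := by field_simp
      rw [e1, e2, e3, e4]
      have h1 : t i ^ (-g) * t i ^ g = 1 := by rw [← Real.rpow_add hti]; simp
      have h2 : w i ^ (-g) * w i ^ g = 1 := by rw [← Real.rpow_add hwi]; simp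
      linear_combination (s i ^ g * (w i ^ (-g) * w i ^ g)) * h1 + s i ^ g * h2) hpos
  refine ⟨h1, h2, ?_⟩
  have e1 : -g * (1 / g) = -1 := by field_simp
  have e2 : -g * (1 / a) = -(g / a) := by ring
  rw [holderGap, mul_sub, mul_add, ← mul_assoc, ← mul_assoc, ← mul_assoc, e1, e2, mul_one_div]
  linarith

/-- Solving for w/(ts), the mixed term is ((w/t)^a)^(b/a) · (s^g)^(-b/g). It applies when g has the
sign opposite to a and b. Nothing cancels, so no support condition is needed. -/
lemma holder_product (hP : ∀ i, 0 ≤ P i) (ht : ∀ i, 0 ≤ t i) (hs : ∀ i, 0 ≤ s i)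
    (hw : ∀ i, 0 ≤ w i) (ha : a ≠ 0) (hb : b ≠ 0) (hg : g ≠ 0) (hrel : 1 / a = 1 / b + 1 / g)
    (hba : 0 < b / a) (hbg : 0 < -b / g)
    (hpos : 0 < ∑ i, P i * ((t i * s i) ^ (-b) * w i ^ b)) :
    0 < ∑ i, P i * (t i ^ (-a) * w i ^ a) ∧ 0 < ∑ i, P i * s i ^ g ∧
      0 ≤ -b * holderGap P t s w a b g := by
  obtain ⟨h1, h2, h3⟩ := logb_sum_le (P := P) (F := fun i => t i ^ (-a) * w i ^ a)
    (G := fun i => s i ^ g) (T := fun i => (t i * s i) ^ (-b) * w i ^ b) hP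
    (fun i => mul_nonneg (Real.rpow_nonneg (ht i) _) (Real.rpow_nonneg (hw i) _))
    (fun i => Real.rpow_nonneg (hs i) _) hba hbg
    (by rw [div_eq_mul_one_div b a, hrel]; field_simp; ring)
    (fun i hi => by
      rw [Real.mul_rpow (ht i) (hs i),
        Real.mul_rpow (Real.rpow_nonneg (ht i) _) (Real.rpow_nonneg (hw i) _),
        ← Real.rpow_mul (ht i), ← Real.rpow_mul (hs i), ← Real.rpow_mul (hw i)]
      have e1 : -a * (b / a) = -b := by field_simp
      have e2 : a * (b / a) = b := by field_simp
      have e3 : g * (-b / g) = -b := by field_simp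
      rw [e1, e2, e3]
      ring) hpos
  refine ⟨h1, h2, ?_⟩
  have e1 : -b * (1 / b) = -1 := by field_simp
  have e2 : -b * (1 / a) = -(b / a) := by ring
  rw [holderGap, mul_sub, mul_add, ← mul_assoc, ← mul_assoc, ← mul_assoc, e1, e2, mul_one_div]
  linarith

end Holder

/-! ### Both Hölder inequalities as one logarithmic bound. -/

section Variational

variable {n : Type*} [Fintype n] [DecidableEq n]

/-- The two Hölder inequalities for Schatten quasi-norms in logarithmic form. -/
lemma one_div_hat_mul_logb_le {L : Matrix n n ℂ} (hL : L.PosSemidef) (h0 : L ≠ 0)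
    {W : Matrix n n ℂ} (hW : W ∈ unitaryGroup n ℂ) {w : n → ℝ} (hw : ∀ k, 0 ≤ w k)
    (hw1 : ∑ k, w k = 1) {p : ℝ} (hp0 : 0 < p) (hp1 : p ≠ 1)
    (hker : p < 1 → ∀ k, w k = 0 → diagEntry W L k = 0)
    (hpos : 0 < ∑ k, diagEntry W L k * w k ^ hat p) :
    1 / hat p * Real.logb 2 (∑ k, diagEntry W L k * w k ^ hat p) ≤
      1 / hat p * Real.logb 2 (schatten p L) := by
  rcases lt_or_gt_of_ne hp1 with h | h
  · refine mul_le_mul_of_nonpos_left ?_ (one_div_neg.mpr (hat_neg hp0 h)).le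
    exact Real.logb_le_logb_of_le (by norm_num) (schatten_pos hL h0 p)
      (schatten_le_sum_diagEntry_mul hL hW hw hw1 hp0 h (hker h))
  · refine mul_le_mul_of_nonneg_left ?_ (one_div_pos.mpr (hat_pos h)).le
    exact Real.logb_le_logb_of_le (by norm_num) hpos
      (sum_diagEntry_mul_le_schatten hL hW hw hw1 h)

lemma one_div_hat_mul_logb_moment_le {Y X W : Matrix n n ℂ} {d w : n → ℝ} (hd : ∀ i, 0 ≤ d i)
    {p : ℝ} (h0 : compressed p Y X d ≠ 0)
    (hW : W ∈ unitaryGroup n ℂ) (hw : ∀ k, 0 ≤ w k) (hw1 : ∑ k, w k = 1)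
    (hp0 : 0 < p) (hp1 : p ≠ 1)
    (hker : p < 1 → ∀ i k, w k = 0 → weight Y X W i k = 0 ∨ d i = 0)
    (hpos : 0 < moment Y X W d w (hat p)) :
    1 / hat p * Real.logb 2 (moment Y X W d w (hat p)) ≤
      1 / hat p * Real.logb 2 (schatten p (compressed p Y X d)) := by
  rw [← sum_diagEntry_compressed] at hpos ⊢
  refine one_div_hat_mul_logb_le (compressed_posSemidef p Y X hd) h0 hW hw hw1 hp0 hp1
    (fun hp k hk => ?_) hpos
  rw [diagEntry_compressed]
  refine Finset.sum_eq_zero fun i _ => ?_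
  rcases hker hp i k hk with h | h
  · simp [h]
  · simp [h, Real.zero_rpow (neg_ne_zero.mpr (hat_neg hp0 hp).ne)]

end Variational

/-! ### Hölder's inequality for the weights of a bipartite state. -/

section ChainRule

variable {A B : Type*} [Fintype A] [DecidableEq A] [Fintype B] [DecidableEq B]

lemma kronecker_one_eq_conjDiag {V : Matrix B B ℂ} (hV : V ∈ unitaryGroup B ℂ)
    (U : Matrix A A ℂ) (t : A → ℝ) :
    conjDiag U t ⊗ₖ (1 : Matrix B B ℂ) = conjDiag (U ⊗ₖ V) (fun x => t x.1) := by
  rw [← conjDiag_one hV, kronecker_conjDiag]; simp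

/-- The sum `∑ P s^g` over the weights of `X`, where `s` depends on the second factor only. -/
noncomputable def rightMoment (Y X W : Matrix (A × B) (A × B) ℂ) (s : B → ℝ) (g : ℝ) : ℝ :=
  ∑ z : (A × B) × (A × B), weight Y X W z.1 z.2 * s z.1.2 ^ g

/-- `holderGap` for the weights of `X`. -/
noncomputable def weightGap (Y X W : Matrix (A × B) (A × B) ℂ) (dα dβ : A × B → ℝ) (s : B → ℝ)
    (w : A × B → ℝ) (a b g : ℝ) : ℝ :=
  1 / b * Real.logb 2 (moment Y X W dβ w b) +
    1 / g * Real.logb 2 (rightMoment Y X W s g) -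
    1 / a * Real.logb 2 (moment Y X W dα w a)

variable {Y X W : Matrix (A × B) (A × B) ℂ} {t : A → ℝ} {s : B → ℝ}
  {dα dβ w : A × B → ℝ} {a b g : ℝ}

omit [DecidableEq A] [DecidableEq B]

lemma weight_holder_quotient (hdα : ∀ x, dα x = t x.1)
    (hdβ : ∀ x, dβ x = t x.1 * s x.2) (ht : ∀ i, 0 ≤ t i) (hs : ∀ i, 0 ≤ s i)
    (hw : ∀ i, 0 ≤ w i) (ha : a ≠ 0) (hb : b ≠ 0) (hg : g ≠ 0) (hrel : 1 / a = 1 / b + 1 / g)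
    (hab : 0 < a / b) (hag : 0 < a / g) (hs' : ∀ x k, weight Y X W x k ≠ 0 → s x.2 ≠ 0)
    (hpos : 0 < moment Y X W dα w a) :
    0 < moment Y X W dβ w b ∧ 0 < rightMoment Y X W s g ∧
      0 ≤ a * weightGap Y X W dα dβ s w a b g := by
  obtain rfl := funext hdα
  obtain rfl := funext hdβ
  exact holder_quotient (P := fun z : (A × B) × (A × B) => weight Y X W z.1 z.2)
    (t := fun z => t z.1.1) (s := fun z => s z.1.2) (w := fun z => w z.2)
    (fun z => weight_nonneg Y X W z.1 z.2) (fun z => ht z.1.1) (fun z => hs z.1.2)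
    (fun z => hw z.2) ha hb hg hrel hab hag (fun z => hs' z.1 z.2) hpos

lemma weight_holder_left (hdα : ∀ x, dα x = t x.1)
    (hdβ : ∀ x, dβ x = t x.1 * s x.2) (ht : ∀ i, 0 ≤ t i) (hs : ∀ i, 0 ≤ s i)
    (hw : ∀ i, 0 ≤ w i) (ha : a ≠ 0) (hb : b ≠ 0) (hg : g ≠ 0) (hrel : 1 / a = 1 / b + 1 / g)
    (hga : 0 < g / a) (hgb : 0 < -g / b) (ht' : ∀ x k, weight Y X W x k ≠ 0 → t x.1 ≠ 0)
    (hw' : ∀ x k, weight Y X W x k ≠ 0 → w k ≠ 0) (hpos : 0 < rightMoment Y X W s g) :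
    0 < moment Y X W dα w a ∧ 0 < moment Y X W dβ w b ∧
      0 ≤ -g * weightGap Y X W dα dβ s w a b g := by
  obtain rfl := funext hdα
  obtain rfl := funext hdβ
  exact holder_left (P := fun z : (A × B) × (A × B) => weight Y X W z.1 z.2)
    (t := fun z => t z.1.1) (s := fun z => s z.1.2) (w := fun z => w z.2)
    (fun z => weight_nonneg Y X W z.1 z.2) (fun z => ht z.1.1) (fun z => hs z.1.2)
    (fun z => hw z.2) ha hb hg hrel hga hgb (fun z => ht' z.1 z.2) (fun z => hw' z.1 z.2) hpos

lemma weight_holder_product (hdα : ∀ x, dα x = t x.1)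
    (hdβ : ∀ x, dβ x = t x.1 * s x.2) (ht : ∀ i, 0 ≤ t i) (hs : ∀ i, 0 ≤ s i)
    (hw : ∀ i, 0 ≤ w i) (ha : a ≠ 0) (hb : b ≠ 0) (hg : g ≠ 0) (hrel : 1 / a = 1 / b + 1 / g)
    (hba : 0 < b / a) (hbg : 0 < -b / g)
    (hpos : 0 < moment Y X W dβ w b) :
    0 < moment Y X W dα w a ∧ 0 < rightMoment Y X W s g ∧
      0 ≤ -b * weightGap Y X W dα dβ s w a b g := by
  obtain rfl := funext hdα
  obtain rfl := funext hdβ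
  exact holder_product (P := fun z : (A × B) × (A × B) => weight Y X W z.1 z.2)
    (t := fun z => t z.1.1) (s := fun z => s z.1.2) (w := fun z => w z.2)
    (fun z => weight_nonneg Y X W z.1 z.2) (fun z => ht z.1.1) (fun z => hs z.1.2)
    (fun z => hw z.2) ha hb hg hrel hba hbg hpos

end ChainRule

/-! ### The chain inequalities at orders different from 0 and 1. -/

section ChainRule

variable {A B : Type*} [Fintype A] [DecidableEq A] [Fintype B] [DecidableEq B]

/-- With ω optimal for order α, the α-moment equals its norm. Hölder makes the gap non-negative, and
replacing the β- and γ-moments by their norms only increases it. -/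
lemma chain_lower_bound {α β γ : ℝ} (hα : 0 < α) (hβ : 0 < β) (hγ : 0 < γ)
    (hrel : 1 / hat α = 1 / hat β + 1 / hat γ)
    (hcase : (1 < α ∧ 1 < β ∧ 1 < γ) ∨ (α < 1 ∧ 1 < β ∧ γ < 1) ∨ (α < 1 ∧ β < 1 ∧ 1 < γ))
    {ρ X : Matrix (A × B) (A × B) ℂ} (hρ : IsDensity ρ) (hX : X * Xᴴ = ρ)
    {U : Matrix A A ℂ} (hU : U ∈ unitaryGroup A ℂ) {t : A → ℝ} (ht : ∀ i, 0 ≤ t i)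
    {dα dβ : A × B → ℝ} (hdα : ∀ x, dα x = t x.1)
    {V : Matrix B B ℂ} (hV : V ∈ unitaryGroup B ℂ) {s : B → ℝ} (hs : ∀ j, 0 ≤ s j)
    (hdβ : ∀ x, dβ x = t x.1 * s x.2)
    (hs1 : ∑ j, s j = 1)
    (hα0 : compressed α (U ⊗ₖ V) X dα ≠ 0)
    (hβ0 : compressed β (U ⊗ₖ V) X dβ ≠ 0)
    (hdom : 1 < β → ∀ W ∈ unitaryGroup (A × B) ℂ, ∀ x k, t x.1 * s x.2 = 0 →
      weight (U ⊗ₖ V) X W x k = 0) :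
    -(1 / hat γ * Real.logb 2 (schatten γ (reducedRight ρ))) +
      1 / hat α * Real.logb 2 (schatten α (compressed α (U ⊗ₖ V) X dα)) ≤
    1 / hat β * Real.logb 2 (schatten β (compressed β (U ⊗ₖ V) X dβ)) := by
  have hα1 : α ≠ 1 := by rcases hcase with h | h | h <;> [exact h.1.ne'; exact h.1.ne; exact h.1.ne]
  have hβ1 : β ≠ 1 := by
    rcases hcase with h | h | h <;> [exact h.2.1.ne'; exact h.2.1.ne'; exact h.2.1.ne]
  have hγ1 : γ ≠ 1 := by
    rcases hcase with h | h | h <;> [exact h.2.2.ne'; exact h.2.2.ne; exact h.2.2.ne']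
  have hdα0 : ∀ x, 0 ≤ dα x := fun x => (ht x.1).trans_eq (hdα x).symm
  have hts : ∀ x, 0 ≤ dβ x := fun x => (mul_nonneg (ht _) (hs _)).trans_eq (hdβ x).symm
  have hρB := reducedRight_isDensity hρ
  obtain ⟨W, hW, w, hw, hw1, hker, heq⟩ := exists_moment_eq_schatten hdα0 hα hα0
  have hS : rightMoment (U ⊗ₖ V) X W s (hat γ) =
      ∑ j, diagEntry V (reducedRight ρ) j * s j ^ hat γ :=
    sum_weight_kronecker hU V hX hW (fun j => s j ^ hat γ)
  have hkerγ : γ < 1 → ∀ j, s j = 0 → diagEntry V (reducedRight ρ) j = 0 := by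
    intro h j hj
    -- Among the admissible patterns γ < 1 forces β > 1, where domination is available and passes to
    -- σ over ρ_B.
    have h1β : 1 < β := by rcases hcase with h' | h' | h' <;> linarith
    exact diagEntry_reducedRight_eq_zero hU hX hW fun i k => hdom h1β W hW (i, j) k (by simp [hj])
  have hkerβ : ∀ x k, w k = 0 → weight (U ⊗ₖ V) X W x k = 0 ∨ dβ x = 0 := by
    intro x k hk
    rcases hker x k hk with h | h
    · exact Or.inl h
    · exact Or.inr (by rw [hdα] at h; simp [hdβ, h])
  have hmα : 0 < moment (U ⊗ₖ V) X W dα w (hat α) := by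
    rw [heq]; exact schatten_pos (compressed_posSemidef _ _ _ hdα0) hα0 α
  have ha := hat_ne_zero hα hα1
  have hb := hat_ne_zero hβ hβ1
  have hg := hat_ne_zero hγ hγ1
  have key : 0 < moment (U ⊗ₖ V) X W dβ w (hat β) ∧
      0 < rightMoment (U ⊗ₖ V) X W s (hat γ) ∧
      0 ≤ weightGap (U ⊗ₖ V) X W dα dβ s w (hat α) (hat β) (hat γ) := by
    -- In each pattern the mixed term of Hölder must be known to be positive: by optimality of ω in
    -- the first, by the reverse Hölder inequality in the other two.
    rcases hcase with ⟨h1, h2, h3⟩ | ⟨h1, h2, h3⟩ | ⟨h1, h2, h3⟩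
    · have pa := hat_pos h1
      have pb := hat_pos h2
      have pg := hat_pos h3
      obtain ⟨k1, k2, k3⟩ := weight_holder_quotient hdα hdβ ht hs hw ha hb hg hrel (div_pos pa pb) (div_pos pa pg)
        (fun x k hz h0 => hz (hdom h2 W hW x k (by simp [h0]))) hmα
      exact ⟨k1, k2, nonneg_of_mul_nonneg_right k3 pa⟩
    · have pa := hat_neg hα h1
      have pb := hat_pos h2
      have pg := hat_neg hγ h3
      have hpos : 0 < rightMoment (U ⊗ₖ V) X W s (hat γ) := by
        rw [hS]
        exact (schatten_pos hρB.1 hρB.ne_zero γ).trans_le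
          (schatten_le_sum_diagEntry_mul hρB.1 hV hs hs1 hγ h3 (hkerγ h3))
      obtain ⟨k1, k2, k3⟩ := weight_holder_left hdα hdβ ht hs hw ha hb hg hrel (div_pos_of_neg_of_neg pg pa) (div_pos (neg_pos.mpr pg) pb)
        (fun x k hz h0 => hz (hdom h2 W hW x k (by simp [h0])))
        (fun x k hz h0 => (hkerβ x k h0).elim hz fun h => hz (hdom h2 W hW x k (hdβ x ▸ h))) hpos
      exact ⟨k2, hpos, nonneg_of_mul_nonneg_right k3 (neg_pos.mpr pg)⟩
    · have pa := hat_neg hα h1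
      have pb := hat_neg hβ h2
      have pg := hat_pos h3
      have hpos := (schatten_pos (compressed_posSemidef β (U ⊗ₖ V) X hts) hβ0 β).trans_le
        (schatten_le_moment hts hW hw hw1 hβ h2 hkerβ)
      obtain ⟨k1, k2, k3⟩ := weight_holder_product hdα hdβ ht hs hw ha hb hg hrel (div_pos_of_neg_of_neg pb pa) (div_pos (neg_pos.mpr pb) pg)
        hpos
      exact ⟨hpos, k2, nonneg_of_mul_nonneg_right k3 (neg_pos.mpr pb)⟩
  obtain ⟨k1, k2, k3⟩ := key
  have hβ' := one_div_hat_mul_logb_moment_le hts hβ0 hW hw hw1 hβ hβ1 (fun _ => hkerβ) k1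
  rw [hS] at k2
  have hγ' := one_div_hat_mul_logb_le hρB.1 hρB.ne_zero hV hs hs1 hγ hγ1 hkerγ k2
  rw [weightGap, heq, hS] at k3
  have arith : ∀ A B B' S S' : ℝ, 0 ≤ B' + S' - A → B' ≤ B → S' ≤ S → -S + A ≤ B := by
    intros; linarith
  exact arith _ _ _ _ _ k3 hβ' hγ'

/-- With σ optimal for γ and ω optimal for β, two moments equal their norms. Hölder makes the gap
non-positive, and the α-moment is bounded by its norm. -/
lemma chain_upper_bound {α β γ : ℝ} (hα : 0 < α) (hβ : 0 < β) (hγ : 0 < γ)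
    (hrel : 1 / hat α = 1 / hat β + 1 / hat γ)
    (hcase : (1 < α ∧ 1 < β ∧ γ < 1) ∨ (1 < α ∧ β < 1 ∧ 1 < γ) ∨ (α < 1 ∧ β < 1 ∧ γ < 1))
    {ρ X : Matrix (A × B) (A × B) ℂ} (hX : X * Xᴴ = ρ)
    {U : Matrix A A ℂ} (hU : U ∈ unitaryGroup A ℂ) {t : A → ℝ} (ht : ∀ i, 0 ≤ t i)
    {dα dβ : A × B → ℝ} (hdα : ∀ x, dα x = t x.1)
    {V : Matrix B B ℂ} {s : B → ℝ} (hs : ∀ j, 0 ≤ s j)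
    (hdβ : ∀ x, dβ x = t x.1 * s x.2)
    (hsγ : ∑ j, diagEntry V (reducedRight ρ) j * s j ^ hat γ = schatten γ (reducedRight ρ))
    (hsγ0 : 0 < schatten γ (reducedRight ρ))
    (hsker : ∀ W ∈ unitaryGroup (A × B) ℂ, ∀ x k, s x.2 = 0 → weight (U ⊗ₖ V) X W x k = 0)
    (hα0 : compressed α (U ⊗ₖ V) X dα ≠ 0)
    (hβ0 : compressed β (U ⊗ₖ V) X dβ ≠ 0)
    (hdom : 1 < α → ∀ W ∈ unitaryGroup (A × B) ℂ, ∀ x k, t x.1 = 0 →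
      weight (U ⊗ₖ V) X W x k = 0) :
    1 / hat β * Real.logb 2 (schatten β (compressed β (U ⊗ₖ V) X dβ)) ≤
    -(1 / hat γ * Real.logb 2 (schatten γ (reducedRight ρ))) +
      1 / hat α * Real.logb 2 (schatten α (compressed α (U ⊗ₖ V) X dα)) := by
  have hα1 : α ≠ 1 := by
    rcases hcase with h | h | h <;> [exact h.1.ne'; exact h.1.ne'; exact h.1.ne]
  have hβ1 : β ≠ 1 := by
    rcases hcase with h | h | h <;> [exact h.2.1.ne'; exact h.2.1.ne; exact h.2.1.ne]
  have hγ1 : γ ≠ 1 := by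
    rcases hcase with h | h | h <;> [exact h.2.2.ne; exact h.2.2.ne'; exact h.2.2.ne]
  have hdα0 : ∀ x, 0 ≤ dα x := fun x => (ht x.1).trans_eq (hdα x).symm
  have hts : ∀ x, 0 ≤ dβ x := fun x => (mul_nonneg (ht _) (hs _)).trans_eq (hdβ x).symm
  obtain ⟨W, hW, w, hw, hw1, hker, heq⟩ := exists_moment_eq_schatten hts hβ hβ0
  have hS : rightMoment (U ⊗ₖ V) X W s (hat γ) =
      ∑ j, diagEntry V (reducedRight ρ) j * s j ^ hat γ :=
    sum_weight_kronecker hU V hX hW (fun j => s j ^ hat γ)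
  rw [hsγ] at hS
  have hkerα : ∀ x k, w k = 0 → weight (U ⊗ₖ V) X W x k = 0 ∨ dα x = 0 := by
    intro x k hk
    rcases hker x k hk with h | h
    · exact Or.inl h
    · rw [hdβ] at h
      rcases mul_eq_zero.mp h with h | h
      · exact Or.inr (by rw [hdα, h])
      · exact Or.inl (hsker W hW x k h)
  have hmβ : 0 < moment (U ⊗ₖ V) X W dβ w (hat β) := by
    rw [heq]; exact schatten_pos (compressed_posSemidef _ _ _ hts) hβ0 β
  have ha := hat_ne_zero hα hα1
  have hb := hat_ne_zero hβ hβ1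
  have hg := hat_ne_zero hγ hγ1
  have key : 0 < moment (U ⊗ₖ V) X W dα w (hat α) ∧
      weightGap (U ⊗ₖ V) X W dα dβ s w (hat α) (hat β) (hat γ) ≤ 0 := by
    rcases hcase with ⟨h1, h2, h3⟩ | ⟨h1, h2, h3⟩ | ⟨h1, h2, h3⟩
    · have pa := hat_pos h1
      have pb := hat_pos h2
      have pg := hat_neg hγ h3
      obtain ⟨k1, k2, k3⟩ := weight_holder_product hdα hdβ ht hs hw ha hb hg hrel (div_pos pb pa)
        (div_pos_of_neg_of_neg (neg_neg_of_pos pb) pg) hmβ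
      exact ⟨k1, nonpos_of_mul_nonneg_right k3 (neg_neg_of_pos pb)⟩
    · have pa := hat_pos h1
      have pb := hat_neg hβ h2
      have pg := hat_pos h3
      obtain ⟨k1, k2, k3⟩ := weight_holder_left hdα hdβ ht hs hw ha hb hg hrel (div_pos pg pa)
        (div_pos_of_neg_of_neg (neg_neg_of_pos pg) pb)
        (fun x k hz h0 => hz (hdom h1 W hW x k h0))
        (fun x k hz h0 => (hkerα x k h0).elim hz fun h => hz (hdom h1 W hW x k (hdα x ▸ h)))
        (hsγ0.trans_eq hS.symm)
      exact ⟨k1, nonpos_of_mul_nonneg_right k3 (neg_neg_of_pos pg)⟩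
    · have pa := hat_neg hα h1
      have pb := hat_neg hβ h2
      have pg := hat_neg hγ h3
      have hpos := (schatten_pos (compressed_posSemidef α (U ⊗ₖ V) X hdα0) hα0 α).trans_le
        (schatten_le_moment hdα0 hW hw hw1 hα h1 hkerα)
      obtain ⟨k1, k2, k3⟩ := weight_holder_quotient hdα hdβ ht hs hw ha hb hg hrel (div_pos_of_neg_of_neg pa pb)
        (div_pos_of_neg_of_neg pa pg) (fun x k hz h0 => hz (hsker W hW x k h0)) hpos
      exact ⟨hpos, nonpos_of_mul_nonneg_right k3 pa⟩
  obtain ⟨k1, k3⟩ := key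
  have hα' := one_div_hat_mul_logb_moment_le hdα0 hα0 hW hw hw1 hα hα1
    (fun _ => hkerα) k1
  rw [weightGap, heq, hS] at k3
  have arith : ∀ A A' B S : ℝ, B + S - A' ≤ 0 → A' ≤ A → B ≤ -S + A := by
    intros; linarith
  exact arith _ _ _ _ k3 hα'

/-- Lower bound on the sandwiched divergence from a product, for orders different from `0, 1`. -/
theorem renyiEntropy_add_sandwichedDiv_le {α β γ : ℝ} (hα : 0 < α) (hβ : 0 < β) (hγ : 0 < γ)
    (hrel : 1 / hat α = 1 / hat β + 1 / hat γ)
    (hcase : (1 < α ∧ 1 < β ∧ 1 < γ) ∨ (α < 1 ∧ 1 < β ∧ γ < 1) ∨ (α < 1 ∧ β < 1 ∧ 1 < γ))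
    {ρ : Matrix (A × B) (A × B) ℂ} (hρ : IsDensity ρ) {τ : Matrix A A ℂ} (hτ : τ.PosSemidef)
    {σ : Matrix B B ℂ} (hσ : IsDensity σ) :
    (renyiEntropy γ (reducedRight ρ) : EReal) + sandwichedDiv α ρ (τ ⊗ₖ (1 : Matrix B B ℂ)) ≤
      sandwichedDiv β ρ (τ ⊗ₖ σ) := by
  by_cases hfin : ¬ Orthogonal ρ (τ ⊗ₖ σ) ∧ (Dominates (τ ⊗ₖ σ) ρ ∨ β < 1)
  swap
  · have : sandwichedDiv β ρ (τ ⊗ₖ σ) = ⊤ := if_neg hfin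
    rw [this]; exact le_top
  have hα1 : α ≠ 1 := by rcases hcase with h | h | h <;> [exact h.1.ne'; exact h.1.ne; exact h.1.ne]
  have hβ1 : β ≠ 1 := by
    rcases hcase with h | h | h <;> [exact h.2.1.ne'; exact h.2.1.ne'; exact h.2.1.ne]
  have hγ1 : γ ≠ 1 := by
    rcases hcase with h | h | h <;> [exact h.2.2.ne'; exact h.2.2.ne; exact h.2.2.ne']
  obtain ⟨U, hU, t, ht, rfl⟩ := exists_conjDiag hτ
  obtain ⟨V, hV, s, hs, rfl⟩ := exists_conjDiag hσ.1
  have hs1 : ∑ j, s j = 1 := by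
    have := hσ.2; rw [trace_conjDiag hV] at this; exact_mod_cast this
  obtain ⟨X, hX, -⟩ := sqrt_mul_conjTranspose hρ.1
  have hY := kronecker_mem_unitary hU hV
  rw [kronecker_conjDiag] at hfin ⊢
  rw [kronecker_one_eq_conjDiag hV]
  have hts : ∀ x : A × B, 0 ≤ t x.1 * s x.2 := fun x => mul_nonneg (ht _) (hs _)
  -- The support of τ ⊗ σ lies in that of τ ⊗ 1, so finiteness at order β passes to order α.
  have hort : ¬ Orthogonal ρ (conjDiag (U ⊗ₖ V) (fun x => t x.1)) := by
    refine fun h => hfin.1 ?_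
    rw [orthogonal_iff hX hY hY] at h ⊢
    exact fun i k hi => h i k (left_ne_zero_of_mul hi)
  have hdom : 1 < β → ∀ W ∈ unitaryGroup (A × B) ℂ, ∀ x k, t x.1 * s x.2 = 0 →
      weight (U ⊗ₖ V) X W x k = 0 := fun h W hW =>
    (dominates_iff hX hY hW _).mp (hfin.2.resolve_right (not_lt.mpr h.le))
  have hfinα : ¬ Orthogonal ρ (conjDiag (U ⊗ₖ V) (fun x => t x.1)) ∧
      (Dominates (conjDiag (U ⊗ₖ V) (fun x => t x.1)) ρ ∨ α < 1) := by
    refine ⟨hort, ?_⟩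
    rcases hcase with h | h | h
    · left
      rw [dominates_iff hX hY hY]
      exact fun x k hx => hdom h.2.1 _ hY x k (by simp [hx])
    · exact Or.inr h.1
    · exact Or.inr h.1
  have hρB := reducedRight_isDensity hρ
  rw [sandwichedDiv_conjDiag (d := fun x => t x.1 * s x.2) hX hY hts hβ hβ1 hfin,
    sandwichedDiv_conjDiag (d := fun x => t x.1) hX hY (fun x => ht x.1) hα hα1 hfinα,
    renyiEntropy_eq hρB.1 hρB.ne_zero hγ hγ1, ← EReal.coe_add, EReal.coe_le_coe_iff]
  exact chain_lower_bound hα hβ hγ hrel hcase hρ hX hU ht (fun _ => rfl) hV hs (fun _ => rfl) hs1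
    (compressed_ne_zero (d := fun x => t x.1) hX hY (fun x => ht x.1) hort α) (compressed_ne_zero (d := fun x => t x.1 * s x.2) hX hY hts hfin.1 β) hdom

/-- Upper bound on the sandwiched divergence from a suitable product, for orders different from
`0, 1`. -/
theorem exists_sandwichedDiv_le_renyiEntropy_add {α β γ : ℝ} (hα : 0 < α) (hβ : 0 < β) (hγ : 0 < γ)
    (hrel : 1 / hat α = 1 / hat β + 1 / hat γ)
    (hcase : (1 < α ∧ 1 < β ∧ γ < 1) ∨ (1 < α ∧ β < 1 ∧ 1 < γ) ∨ (α < 1 ∧ β < 1 ∧ γ < 1))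
    {ρ : Matrix (A × B) (A × B) ℂ} (hρ : IsDensity ρ) {τ : Matrix A A ℂ} (hτ : τ.PosSemidef) :
    ∃ σ : Matrix B B ℂ, IsDensity σ ∧ sandwichedDiv β ρ (τ ⊗ₖ σ) ≤
      (renyiEntropy γ (reducedRight ρ) : EReal) + sandwichedDiv α ρ (τ ⊗ₖ (1 : Matrix B B ℂ)) := by
  have hα1 : α ≠ 1 := by
    rcases hcase with h | h | h <;> [exact h.1.ne'; exact h.1.ne'; exact h.1.ne]
  have hβ1 : β ≠ 1 := by
    rcases hcase with h | h | h <;> [exact h.2.1.ne'; exact h.2.1.ne; exact h.2.1.ne]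
  have hγ1 : γ ≠ 1 := by
    rcases hcase with h | h | h <;> [exact h.2.2.ne; exact h.2.2.ne'; exact h.2.2.ne]
  have hρB := reducedRight_isDensity hρ
  -- The witness σ is the optimiser for ‖ρ_B‖_γ, that is ρ_B^γ normalised.
  obtain ⟨V, hV, s, hs, hs1, hsker, hsγ⟩ :=
    exists_sum_diagEntry_mul_eq_schatten hρB.1 hρB.ne_zero hγ
  refine ⟨conjDiag V s, ⟨conjDiag_posSemidef V hs, by rw [trace_conjDiag hV, hs1]; simp⟩, ?_⟩
  by_cases hfin : ¬ Orthogonal ρ (τ ⊗ₖ (1 : Matrix B B ℂ)) ∧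
    (Dominates (τ ⊗ₖ (1 : Matrix B B ℂ)) ρ ∨ α < 1)
  swap
  · have : sandwichedDiv α ρ (τ ⊗ₖ (1 : Matrix B B ℂ)) = ⊤ := if_neg hfin
    rw [this, EReal.coe_add_top]; exact le_top
  obtain ⟨U, hU, t, ht, rfl⟩ := exists_conjDiag hτ
  obtain ⟨X, hX, -⟩ := sqrt_mul_conjTranspose hρ.1
  have hY := kronecker_mem_unitary hU hV
  rw [kronecker_one_eq_conjDiag hV] at hfin ⊢
  rw [kronecker_conjDiag]
  have hts : ∀ x : A × B, 0 ≤ t x.1 * s x.2 := fun x => mul_nonneg (ht _) (hs _)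
  have hsker' : ∀ W ∈ unitaryGroup (A × B) ℂ, ∀ x k, s x.2 = 0 → weight (U ⊗ₖ V) X W x k = 0 :=
    fun W hW x k hx => weight_eq_zero_of_diagEntry_reducedRight hU hX hW (hsker _ hx) x.1 k
  have hort : ¬ Orthogonal ρ (conjDiag (U ⊗ₖ V) (fun x => t x.1 * s x.2)) := by
    refine fun h => hfin.1 ?_
    rw [orthogonal_iff hX hY hY] at h ⊢
    intro x k hx
    by_cases h0 : s x.2 = 0
    · exact hsker' _ hY x k h0
    · exact h x k (mul_ne_zero hx h0)
  have hdom : 1 < α → ∀ W ∈ unitaryGroup (A × B) ℂ, ∀ x k, t x.1 = 0 →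
      weight (U ⊗ₖ V) X W x k = 0 := fun h W hW =>
    (dominates_iff hX hY hW _).mp (hfin.2.resolve_right (not_lt.mpr h.le))
  have hfinβ : ¬ Orthogonal ρ (conjDiag (U ⊗ₖ V) (fun x => t x.1 * s x.2)) ∧
      (Dominates (conjDiag (U ⊗ₖ V) (fun x => t x.1 * s x.2)) ρ ∨ β < 1) := by
    refine ⟨hort, ?_⟩
    rcases hcase with h | h | h
    · left
      rw [dominates_iff hX hY hY]
      exact fun x k hx => (mul_eq_zero.mp hx).elim (hdom h.1 _ hY x k) (hsker' _ hY x k)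
    · exact Or.inr h.2.1
    · exact Or.inr h.2.1
  rw [sandwichedDiv_conjDiag (d := fun x => t x.1 * s x.2) hX hY hts hβ hβ1 hfinβ,
    sandwichedDiv_conjDiag (d := fun x => t x.1) hX hY (fun x => ht x.1) hα hα1 hfin,
    renyiEntropy_eq hρB.1 hρB.ne_zero hγ hγ1, ← EReal.coe_add, EReal.coe_le_coe_iff]
  exact chain_upper_bound hα hβ hγ hrel hcase hX hU ht (fun _ => rfl) hs (fun _ => rfl) hsγ
    (schatten_pos hρB.1 hρB.ne_zero γ) hsker'
    (compressed_ne_zero (d := fun x => t x.1) hX hY (fun x => ht x.1) hfin.1 α) (compressed_ne_zero (d := fun x => t x.1 * s x.2) hX hY hts hort β) hdom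

end ChainRule

/-! ### Comparison of the Rényi quantities with those of order one. -/

section OrderOne

variable {n : Type*} [Fintype n] [DecidableEq n]

lemma sum_weight_right {W : Matrix n n ℂ} (hW : W ∈ unitaryGroup n ℂ) (Y X : Matrix n n ℂ) (i : n) :
    ∑ k, weight Y X W i k = diagEntry Y (X * Xᴴ) i := by
  have h : ∀ k, weight Y X W i k = weight W Xᴴ Y k i := by
    intro k
    have : (Yᴴ * X * W) i k = star ((Wᴴ * Xᴴ * Y) k i) := by
      rw [← conjTranspose_apply, conjTranspose_mul, conjTranspose_mul, Matrix.mul_assoc]; simp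
    rw [weight, this, weight]
    simp
  simp_rw [h]
  rw [sum_weight_left hW, conjTranspose_conjTranspose]

lemma diagEntry_eq_zero_of_dominates {ρ Y : Matrix n n ℂ} (hρ : ρ.PosSemidef)
    (hY : Y ∈ unitaryGroup n ℂ) {d : n → ℝ} (h : Dominates (conjDiag Y d) ρ) {i : n}
    (hi : d i = 0) : diagEntry Y ρ i = 0 := by
  obtain ⟨X, hX, -⟩ := sqrt_mul_conjTranspose hρ
  rw [← hX, ← sum_weight_right hY]
  exact Finset.sum_eq_zero fun k _ => (dominates_iff hX hY hY d).mp h i k hi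

lemma relEntropy_conjDiag {ρ Y : Matrix n n ℂ} (hY : Y ∈ unitaryGroup n ℂ) {d : n → ℝ}
    (h : Dominates (conjDiag Y d) ρ) : relEntropy ρ (conjDiag Y d) =
      (((ρ * mlog ρ).trace.re - ∑ i, diagEntry Y ρ i * Real.logb 2 (d i) : ℝ) : EReal) := by
  rw [relEntropy, if_pos h, mlog_conjDiag hY, Matrix.mul_sub, trace_sub, Complex.sub_re,
    trace_mul_conjDiag]

lemma trace_mul_mlog_conjDiag {V : Matrix n n ℂ} (hV : V ∈ unitaryGroup n ℂ) (r : n → ℝ) :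
    (conjDiag V r * mlog (conjDiag V r)).trace.re = ∑ i, r i * Real.logb 2 (r i) := by
  rw [mlog_conjDiag hV, conjDiag_mul hV, trace_conjDiag hV, Complex.ofReal_re]

/-- Klein's inequality. -/
lemma sum_diagEntry_mul_logb_le_trace {ρ : Matrix n n ℂ} (hρ : IsDensity ρ) {W : Matrix n n ℂ}
    (hW : W ∈ unitaryGroup n ℂ) {w : n → ℝ} (hw : ∀ k, 0 ≤ w k) (hw1 : ∑ k, w k = 1)
    (hker : ∀ k, w k = 0 → diagEntry W ρ k = 0) :
    ∑ k, diagEntry W ρ k * Real.logb 2 (w k) ≤ (ρ * mlog ρ).trace.re := by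
  obtain ⟨V, hV, r, hr, rfl⟩ := exists_conjDiag hρ.1
  have hr1 : ∑ j, r j = 1 := by
    have := hρ.2; rw [trace_conjDiag hV] at this; exact_mod_cast this
  rw [trace_mul_mlog_conjDiag hV]
  exact sum_diagEntry_mul_logb_le hV hr hr1 hW hw hw1 hker

/-- Jensen's inequality for the variable w/d under the weights. Both marginals are diagonals of ρ,
as X Xᴴ = Xᴴ X = ρ, which gives the two logarithmic sums. -/
lemma mul_sub_le_logb_moment {ρ X Y W : Matrix n n ℂ} (hρ : IsDensity ρ) (hX : X * Xᴴ = ρ)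
    (hX' : Xᴴ * X = ρ) (hY : Y ∈ unitaryGroup n ℂ) (hW : W ∈ unitaryGroup n ℂ) {d w : n → ℝ}
    (hd : ∀ i, 0 ≤ d i) (hw : ∀ i, 0 ≤ w i) (hd0 : ∀ i k, weight Y X W i k ≠ 0 → d i ≠ 0)
    (hw0 : ∀ i k, weight Y X W i k ≠ 0 → w k ≠ 0) (e : ℝ) :
    0 < moment Y X W d w e ∧
    e * (∑ k, diagEntry W ρ k * Real.logb 2 (w k) - ∑ i, diagEntry Y ρ i * Real.logb 2 (d i)) ≤
      Real.logb 2 (moment Y X W d w e) := by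
  have hd' : ∀ i k, weight Y X W i k ≠ 0 → 0 < d i := fun i k h =>
    lt_of_le_of_ne (hd i) (Ne.symm (hd0 i k h))
  have hw' : ∀ i k, weight Y X W i k ≠ 0 → 0 < w k := fun i k h =>
    lt_of_le_of_ne (hw k) (Ne.symm (hw0 i k h))
  have hP1 : ∑ z : n × n, weight Y X W z.1 z.2 = 1 := by
    rw [sum_weight hY hW, hX, hρ.2]; simp
  have key := mul_sum_logb_le (P := fun z : n × n => weight Y X W z.1 z.2)
    (y := fun z => w z.2 / d z.1) (fun z => weight_nonneg _ _ _ _ _) hP1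
    (fun z hz => div_pos (hw' _ _ hz) (hd' _ _ hz)) e
  have hpos := sum_mul_rpow_pos (P := fun z : n × n => weight Y X W z.1 z.2)
    (y := fun z => w z.2 / d z.1) (fun z => weight_nonneg _ _ _ _ _) hP1
    (fun z hz => div_pos (hw' _ _ hz) (hd' _ _ hz)) e
  have e1 : ∑ z : n × n, weight Y X W z.1 z.2 * (w z.2 / d z.1) ^ e = moment Y X W d w e := by
    refine Finset.sum_congr rfl fun z _ => ?_
    rw [Real.div_rpow (hw _) (hd _), Real.rpow_neg (hd _), div_eq_mul_inv, mul_comm (_ ^ e)]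
  have e2 : ∑ z : n × n, weight Y X W z.1 z.2 * Real.logb 2 (w z.2 / d z.1) =
      ∑ k, diagEntry W ρ k * Real.logb 2 (w k) - ∑ i, diagEntry Y ρ i * Real.logb 2 (d i) := by
    have h1 : ∀ z : n × n, weight Y X W z.1 z.2 * Real.logb 2 (w z.2 / d z.1) =
        weight Y X W z.1 z.2 * Real.logb 2 (w z.2) -
          weight Y X W z.1 z.2 * Real.logb 2 (d z.1) := by
      intro z
      by_cases hz : weight Y X W z.1 z.2 = 0
      · simp [hz]
      · rw [Real.logb_div (hw' _ _ hz).ne' (hd' _ _ hz).ne', mul_sub]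
    simp only [h1, Finset.sum_sub_distrib, Fintype.sum_prod_type]
    rw [Finset.sum_comm]
    simp_rw [← Finset.sum_mul, sum_weight_left hY, sum_weight_right hW, hX, hX']
  rw [e1, e2] at key
  rw [e1] at hpos
  exact ⟨hpos, key⟩

/-- Taking ω = ρ in the variational formula and applying Jensen gives the bound. -/
lemma relEntropy_le_sandwichedDiv {ρ κ : Matrix n n ℂ} (hρ : IsDensity ρ) (hκ : κ.PosSemidef)
    {p : ℝ} (hp : 1 < p) : relEntropy ρ κ ≤ sandwichedDiv p ρ κ := by
  by_cases hfin : ¬ Orthogonal ρ κ ∧ (Dominates κ ρ ∨ p < 1)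
  swap
  · have : sandwichedDiv p ρ κ = ⊤ := if_neg hfin
    rw [this]; exact le_top
  have hdom := hfin.2.resolve_right (not_lt.mpr hp.le)
  obtain ⟨Y, hY, d, hd, rfl⟩ := exists_conjDiag hκ
  have hp0 : 0 < p := by linarith
  rw [relEntropy_conjDiag hY hdom]
  obtain ⟨R, hR, r, hr, rfl⟩ := exists_conjDiag hρ.1
  obtain ⟨X, hX, hX'⟩ := sqrt_mul_conjTranspose hρ.1
  rw [sandwichedDiv_conjDiag hX hY hd hp0 hp.ne' hfin, EReal.coe_le_coe_iff]
  have hr1 : ∑ j, r j = 1 := by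
    have := hρ.2; rw [trace_conjDiag hR] at this; exact_mod_cast this
  obtain ⟨hpos, h1⟩ := mul_sub_le_logb_moment hρ hX hX' hY hR hd hr
    (fun i k h h0 => h ((dominates_iff hX hY hR d).mp hdom i k h0))
    (fun i k h h0 => h (by
      have := sum_weight_left hY X R k
      rw [hX', diagEntry_conjDiag_self hR, h0,
        Finset.sum_eq_zero_iff_of_nonneg fun j _ => weight_nonneg _ _ _ _ _] at this
      exact this i (Finset.mem_univ _))) (hat p)
  simp only [diagEntry_conjDiag_self hR] at h1
  rw [trace_mul_mlog_conjDiag hR]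
  have hh := hat_pos hp
  rw [one_div, ← div_eq_inv_mul, le_div_iff₀' hh]
  refine h1.trans ?_
  have := one_div_hat_mul_logb_moment_le hd (compressed_ne_zero hX hY hd hfin.1 p) hR hr hr1 hp0
    hp.ne' (fun h => absurd h (not_lt.mpr hp.le)) hpos
  exact le_of_mul_le_mul_left this (one_div_pos.mpr hh)

/-- Here ω is optimal for order p. Jensen gives a bound with the diagonal of ρ against log ω, and
Klein's inequality replaces that term by tr ρ log ρ; dividing by p̂ < 0 reverses the direction. -/
lemma sandwichedDiv_le_relEntropy {ρ κ : Matrix n n ℂ} (hρ : IsDensity ρ) (hκ : κ.PosSemidef)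
    {p : ℝ} (hp0 : 0 < p) (hp : p < 1) : sandwichedDiv p ρ κ ≤ relEntropy ρ κ := by
  by_cases hdom : Dominates κ ρ
  swap
  · have : relEntropy ρ κ = ⊤ := if_neg hdom
    rw [this]; exact le_top
  obtain ⟨Y, hY, d, hd, rfl⟩ := exists_conjDiag hκ
  rw [relEntropy_conjDiag hY hdom]
  obtain ⟨X, hX, hX'⟩ := sqrt_mul_conjTranspose hρ.1
  have hort := not_orthogonal_of_dominates hρ hX hY hdom
  rw [sandwichedDiv_conjDiag hX hY hd hp0 hp.ne ⟨hort, Or.inl hdom⟩, EReal.coe_le_coe_iff]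
  obtain ⟨W, hW, w, hw, hw1, hker, heq⟩ :=
    exists_moment_eq_schatten hd hp0 (compressed_ne_zero hX hY hd hort p)
  have hd0 := (dominates_iff hX hY hW d).mp hdom
  have hker' : ∀ i k, w k = 0 → weight Y X W i k = 0 := fun i k hk =>
    (hker i k hk).elim id (hd0 i k)
  obtain ⟨-, h1⟩ := mul_sub_le_logb_moment hρ hX hX' hY hW hd hw (fun i k h h0 => h (hd0 i k h0))
    (fun i k h h0 => h (hker' i k h0)) (hat p)
  rw [heq] at h1
  have h2 := sum_diagEntry_mul_logb_le_trace hρ hW hw hw1 fun k hk => by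
    rw [← hX', ← sum_weight_left hY]
    exact Finset.sum_eq_zero fun i _ => hker' i k hk
  have hh := hat_neg hp0 hp
  rw [one_div, ← div_eq_inv_mul, div_le_iff_of_neg' hh]
  exact (mul_le_mul_of_nonpos_left (sub_le_sub_right h2 _) hh.le).trans h1

/-- Jensen's inequality for the eigenvalues with exponent p-1. The factor p-1 covers both sides of
order one. -/
lemma mul_renyiEntropy_one_sub_nonneg {ρ : Matrix n n ℂ} (hρ : IsDensity ρ) {p : ℝ} (hp : 0 < p) :
    0 ≤ (p - 1) * (renyiEntropy 1 ρ - renyiEntropy p ρ) := by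
  rcases eq_or_ne p 1 with rfl | hp1
  · simp
  obtain ⟨V, hV, r, hr, rfl⟩ := exists_conjDiag hρ.1
  have hr1 : ∑ j, r j = 1 := by
    have := hρ.2; rw [trace_conjDiag hV] at this; exact_mod_cast this
  rw [renyiEntropy, if_pos rfl, renyiEntropy, if_neg hp1, trace_mul_mlog_conjDiag hV,
    trace_mpow_conjDiag hV]
  have key := mul_sum_logb_le hr hr1 (fun i hi => lt_of_le_of_ne (hr i) (Ne.symm hi)) (p - 1)
  have e : ∀ i, r i * r i ^ (p - 1) = r i ^ p := by
    intro i
    rcases (hr i).eq_or_lt with h | h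
    · simp [← h, Real.zero_rpow hp.ne']
    · nth_rewrite 1 [← Real.rpow_one (r i)]
      rw [← Real.rpow_add h]; ring_nf
  simp only [e] at key
  have h1 : (p - 1) * (1 / (1 - p) * Real.logb 2 (∑ i, r i ^ p)) = -Real.logb 2 (∑ i, r i ^ p) := by
    have : 1 - p ≠ 0 := sub_ne_zero.mpr hp1.symm
    field_simp; ring
  rw [mul_sub, h1]
  linarith

lemma sandwichedDiv_cases (p : ℝ) (ρ κ : Matrix n n ℂ) :
    (∃ r : ℝ, sandwichedDiv p ρ κ = r) ∨ sandwichedDiv p ρ κ = ⊤ := by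
  unfold sandwichedDiv
  split_ifs
  · exact Or.inl ⟨_, rfl⟩
  · exact Or.inr rfl

lemma continuousAt_renyiEntropy {ρ : Matrix n n ℂ} (hρ : ρ.PosSemidef) (h0 : ρ ≠ 0) {p : ℝ}
    (hp0 : 0 < p) (hp1 : p ≠ 1) : ContinuousAt (fun q => renyiEntropy q ρ) p := by
  have hpos := trace_mpow_pos hρ h0 p
  obtain ⟨V, hV, r, hr, rfl⟩ := exists_conjDiag hρ
  rw [trace_mpow_conjDiag hV] at hpos
  have h1 : ContinuousAt (fun q => 1 / (1 - q) * Real.logb 2 (∑ i, r i ^ q)) p := by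
    refine ContinuousAt.mul (ContinuousAt.div continuousAt_const (by fun_prop)
      (sub_ne_zero.mpr hp1.symm)) ?_
    refine ContinuousAt.comp (f := fun q => ∑ i, r i ^ q) (g := Real.logb 2)
      (Real.continuousAt_logb hpos.ne') ?_
    exact tendsto_finsetSum _ fun i _ => Real.continuousAt_const_rpow' hp0.ne'
  refine h1.congr ?_
  filter_upwards [isOpen_ne.mem_nhds hp1] with q hq
  rw [renyiEntropy, if_neg hq, trace_mpow_conjDiag hV]

end OrderOne

/-! ### Products at order one, and the limit α → 0. -/

section Product

variable {A B : Type*} [Fintype A] [DecidableEq A] [Fintype B] [DecidableEq B]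

/-- Since log(ts) = log t + log s on the support, passing from τ ⊗ 1 to τ ⊗ σ subtracts tr ρ_B log
σ. Where ts = 0, the diagonal entry of ρ vanishes and the defaults of the logarithm do no harm. -/
lemma relEntropy_kronecker {ρ : Matrix (A × B) (A × B) ℂ} (hρ : IsDensity ρ)
    {τ : Matrix A A ℂ} (hτ : τ.PosSemidef) {V : Matrix B B ℂ} (hV : V ∈ unitaryGroup B ℂ)
    {s : B → ℝ} (h1 : Dominates (τ ⊗ₖ (1 : Matrix B B ℂ)) ρ)
    (hs : ∀ j, s j = 0 → diagEntry V (reducedRight ρ) j = 0) :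
    ∃ v : ℝ, relEntropy ρ (τ ⊗ₖ (1 : Matrix B B ℂ)) = v ∧
      relEntropy ρ (τ ⊗ₖ conjDiag V s) =
        ((v - ∑ j, diagEntry V (reducedRight ρ) j * Real.logb 2 (s j) : ℝ) : EReal) := by
  obtain ⟨U, hU, t, ht, rfl⟩ := exists_conjDiag hτ
  obtain ⟨X, hX, -⟩ := sqrt_mul_conjTranspose hρ.1
  have hY := kronecker_mem_unitary hU hV
  rw [kronecker_one_eq_conjDiag hV] at h1 ⊢
  rw [kronecker_conjDiag]
  have hwt : ∀ x k, s x.2 = 0 → weight (U ⊗ₖ V) X (U ⊗ₖ V) x k = 0 := fun x k hx =>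
    weight_eq_zero_of_diagEntry_reducedRight hU hX hY (hs _ hx) x.1 k
  have h2 : Dominates (conjDiag (U ⊗ₖ V) (fun x => t x.1 * s x.2)) ρ := by
    rw [dominates_iff hX hY hY] at h1 ⊢
    exact fun x k hx => (mul_eq_zero.mp hx).elim (h1 x k) (hwt x k)
  refine ⟨_, relEntropy_conjDiag hY h1, ?_⟩
  rw [relEntropy_conjDiag hY h2]
  congr 1
  have e1 : ∑ j, diagEntry V (reducedRight ρ) j * Real.logb 2 (s j) =
      ∑ x, diagEntry (U ⊗ₖ V) ρ x * Real.logb 2 (s x.2) := by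
    rw [← sum_weight_kronecker hU V hX hY, Fintype.sum_prod_type]
    simp_rw [← Finset.sum_mul, sum_weight_right hY, hX]
  rw [e1, sub_sub, ← Finset.sum_add_distrib]
  congr 1
  refine Finset.sum_congr rfl fun x _ => ?_
  by_cases hx : t x.1 * s x.2 = 0
  · simp [diagEntry_eq_zero_of_dominates hρ.1 hY h2 hx]
  · rw [Real.logb_mul (left_ne_zero_of_mul hx) (right_ne_zero_of_mul hx), mul_add]

lemma renyiEntropy_one_add_relEntropy_le {ρ : Matrix (A × B) (A × B) ℂ} (hρ : IsDensity ρ)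
    {τ : Matrix A A ℂ} (hτ : τ.PosSemidef) {σ : Matrix B B ℂ} (hσ : IsDensity σ) :
    (renyiEntropy 1 (reducedRight ρ) : EReal) + relEntropy ρ (τ ⊗ₖ (1 : Matrix B B ℂ)) ≤
      relEntropy ρ (τ ⊗ₖ σ) := by
  by_cases hdom : Dominates (τ ⊗ₖ σ) ρ
  swap
  · have : relEntropy ρ (τ ⊗ₖ σ) = ⊤ := if_neg hdom
    rw [this]; exact le_top
  obtain ⟨V, hV, s, hs, rfl⟩ := exists_conjDiag hσ.1
  have hs1 : ∑ j, s j = 1 := by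
    have := hσ.2; rw [trace_conjDiag hV] at this; exact_mod_cast this
  have hker : ∀ j, s j = 0 → diagEntry V (reducedRight ρ) j = 0 := by
    intro j hj
    obtain ⟨U, hU, t, ht, rfl⟩ := exists_conjDiag hτ
    obtain ⟨X, hX, -⟩ := sqrt_mul_conjTranspose hρ.1
    have hY := kronecker_mem_unitary hU hV
    rw [kronecker_conjDiag, dominates_iff hX hY hY] at hdom
    exact diagEntry_reducedRight_eq_zero hU hX hY fun i k => hdom (i, j) k (by simp [hj])
  have hdom1 : Dominates (τ ⊗ₖ (1 : Matrix B B ℂ)) ρ := by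
    obtain ⟨U, hU, t, ht, rfl⟩ := exists_conjDiag hτ
    obtain ⟨X, hX, -⟩ := sqrt_mul_conjTranspose hρ.1
    have hY := kronecker_mem_unitary hU hV
    rw [kronecker_conjDiag, dominates_iff hX hY hY] at hdom
    rw [kronecker_one_eq_conjDiag hV, dominates_iff hX hY hY]
    exact fun x k hx => hdom x k (by simp [hx])
  obtain ⟨v, hv1, hv2⟩ := relEntropy_kronecker hρ hτ hV hdom1 hker
  rw [hv1, hv2, renyiEntropy, if_pos rfl, ← EReal.coe_add, EReal.coe_le_coe_iff]
  have := sum_diagEntry_mul_logb_le_trace (reducedRight_isDensity hρ) hV hs hs1 hker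
  linarith

/-- For σ = ρ_B the subtracted term is tr ρ_B log ρ_B, so Klein's inequality holds with equality. -/
lemma relEntropy_reducedRight_le {ρ : Matrix (A × B) (A × B) ℂ} (hρ : IsDensity ρ)
    {τ : Matrix A A ℂ} (hτ : τ.PosSemidef) :
    relEntropy ρ (τ ⊗ₖ reducedRight ρ) ≤
      (renyiEntropy 1 (reducedRight ρ) : EReal) + relEntropy ρ (τ ⊗ₖ (1 : Matrix B B ℂ)) := by
  by_cases hdom : Dominates (τ ⊗ₖ (1 : Matrix B B ℂ)) ρ
  swap
  · have : relEntropy ρ (τ ⊗ₖ (1 : Matrix B B ℂ)) = ⊤ := if_neg hdom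
    rw [this, EReal.coe_add_top]; exact le_top
  obtain ⟨V, hV, s, hs, hVs⟩ := exists_conjDiag (reducedRight_isDensity hρ).1
  have hself : ∀ j, diagEntry V (reducedRight ρ) j = s j := fun j => by
    rw [hVs, diagEntry_conjDiag_self hV]
  obtain ⟨v, hv1, hv2⟩ := relEntropy_kronecker (s := s) hρ hτ hV hdom fun j hj => by rw [hself, hj]
  simp only [hself] at hv2
  rw [← hVs] at hv2
  rw [hv1, hv2, renyiEntropy, if_pos rfl, ← EReal.coe_add, EReal.coe_le_coe_iff, hVs,
    trace_mul_mlog_conjDiag hV]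
  linarith

/-- The lower bound for `α = 0`, as the limit of the bounds for small positive orders. -/
lemma renyiEntropy_add_limsup_le {β γ : ℝ} (hβ : 1 / 2 < β) (hγ : 0 < γ) (hβ1 : β ≠ 1)
    (hrel : β + γ = 2 * β * γ) {ρ : Matrix (A × B) (A × B) ℂ} (hρ : IsDensity ρ)
    {τ : Matrix A A ℂ} (hτ : τ.PosSemidef) {σ : Matrix B B ℂ} (hσ : IsDensity σ) :
    (renyiEntropy γ (reducedRight ρ) : EReal) +
        Filter.limsup (fun a : ℝ => sandwichedDiv a ρ (τ ⊗ₖ (1 : Matrix B B ℂ))) (𝓝[>] 0) ≤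
      sandwichedDiv β ρ (τ ⊗ₖ σ) := by
  rcases sandwichedDiv_cases β ρ (τ ⊗ₖ σ) with ⟨v, hv⟩ | hv
  swap
  · rw [hv]; exact le_top
  have hβ' : β - 1 ≠ 0 := sub_ne_zero.mpr hβ1
  have hβ2 : 2 * β - 1 ≠ 0 := by linarith
  have hγe : γ = β / (2 * β - 1) := by rw [eq_div_iff hβ2]; linarith
  have hγβ : (γ < 1 ↔ 1 < β) := by
    rw [hγe, div_lt_one (by linarith)]; constructor <;> intro h <;> linarith
  have hγ1 : γ ≠ 1 := by
    rw [hγe]; intro h; rw [div_eq_one_iff_eq hβ2] at h; exact hβ1 (by linarith)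
  -- For α = a and fixed β, the order γ_a demanded by the relation satisfies γ_a/(γ_a - 1) = g(a).
  -- The map x ↦ x/(x-1) is an involution, so γ_a = f(a), and f(0) = γ.
  set g : ℝ → ℝ := fun a => a / (a - 1) - β / (β - 1) with hg
  set f : ℝ → ℝ := fun a => g a / (g a - 1) with hf
  have hg0 : g 0 - 1 ≠ 0 := by
    simp only [hg, zero_div, zero_sub]
    intro h
    field_simp at h
    exact hβ2 (by linarith)
  have hf0 : f 0 = γ := by
    simp only [hf]
    rw [hγe, div_eq_div_iff hg0 hβ2]
    simp only [hg]
    field_simp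
    ring
  have hgc : ContinuousAt g 0 := by
    refine ContinuousAt.sub (ContinuousAt.div continuousAt_id (by fun_prop) (by norm_num)) ?_
    exact continuousAt_const
  have hfc : ContinuousAt f 0 := hgc.div (hgc.sub continuousAt_const) hg0
  have hft : Filter.Tendsto f (𝓝[>] 0) (𝓝 γ) := hf0 ▸ hfc.mono_left nhdsWithin_le_nhds
  have hρB := reducedRight_isDensity hρ
  have hH : Filter.Tendsto (fun a => renyiEntropy (f a) (reducedRight ρ)) (𝓝[>] 0)
      (𝓝 (renyiEntropy γ (reducedRight ρ))) :=
    (continuousAt_renyiEntropy hρB.1 hρB.ne_zero hγ hγ1).tendsto.comp hft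
  -- Near 0, f(a) stays on the same side of 1 as γ, which keeps the sign pattern admissible.
  have hside : ∀ᶠ a in 𝓝[>] (0 : ℝ), (1 < β ∧ f a < 1) ∨ (β < 1 ∧ 1 < f a) := by
    rcases lt_or_gt_of_ne hγ1 with h | h
    · filter_upwards [hft.eventually (gt_mem_nhds h)] with a ha
      exact Or.inl ⟨hγβ.mp h, ha⟩
    · filter_upwards [hft.eventually (lt_mem_nhds h)] with a ha
      refine Or.inr ⟨lt_of_le_of_ne (not_lt.mp fun h' => ?_) hβ1, ha⟩
      linarith [hγβ.mpr h']
  have hev : ∀ᶠ a in 𝓝[>] (0 : ℝ), sandwichedDiv a ρ (τ ⊗ₖ (1 : Matrix B B ℂ)) ≤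
      ((v - renyiEntropy (f a) (reducedRight ρ) : ℝ) : EReal) := by
    filter_upwards [Ioo_mem_nhdsGT (zero_lt_one (α := ℝ)), hft.eventually (lt_mem_nhds hγ),
      hside] with a ha hfa hs
    have ha1 : a - 1 ≠ 0 := by linarith [ha.2]
    have hf1 : f a - 1 ≠ 0 := by
      rcases hs with h | h
      · linarith [h.2]
      · linarith [h.2]
    have hga : g a - 1 ≠ 0 := by
      intro h
      simp only [hf, h, div_zero] at hfa
      exact lt_irrefl _ hfa
    have hr : 1 / hat a = 1 / hat β + 1 / hat (f a) := by
      simp only [one_div_hat]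
      have : f a / (f a - 1) = g a := by
        rw [div_eq_iff hf1]
        simp only [hf]
        field_simp
        ring
      rw [this]
      simp only [hg]
      ring
    have hmain := renyiEntropy_add_sandwichedDiv_le ha.1 (by linarith) hfa hr
      (by
        rcases hs with h | h
        · exact Or.inr (Or.inl ⟨ha.2, h.1, h.2⟩)
        · exact Or.inr (Or.inr ⟨ha.2, h.1, h.2⟩)) hρ hτ hσ
    rw [hv] at hmain
    rcases sandwichedDiv_cases a ρ (τ ⊗ₖ (1 : Matrix B B ℂ)) with ⟨u, hu⟩ | hu
    · rw [hu, ← EReal.coe_add, EReal.coe_le_coe_iff] at hmain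
      rw [hu, EReal.coe_le_coe_iff]
      linarith
    · rw [hu, EReal.coe_add_top] at hmain
      exact absurd (lt_of_lt_of_le (EReal.coe_lt_top v) hmain) (lt_irrefl _)
  have hlim : Filter.Tendsto
      (fun a => ((v - renyiEntropy (f a) (reducedRight ρ) : ℝ) : EReal)) (𝓝[>] 0)
      (𝓝 ((v - renyiEntropy γ (reducedRight ρ) : ℝ) : EReal)) :=
    (continuous_coe_real_ereal.tendsto _).comp (tendsto_const_nhds.sub hH)
  have hle := (Filter.limsup_le_limsup hev).trans_eq hlim.limsup_eq
  rw [hv]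
  refine (add_le_add_right hle _).trans_eq ?_
  rw [← EReal.coe_add, add_sub_cancel]

end Product

/-! ### Admissible sign patterns of the orders. -/

section Exponents

variable {α β γ : ℝ}

lemma one_div_hat_eq_add (hα1 : α ≠ 1) (hβ1 : β ≠ 1) (hγ1 : γ ≠ 1)
    (hrel : α * β * γ - 2 * β * γ - α + β + γ = 0) : 1 / hat α = 1 / hat β + 1 / hat γ := by
  simp only [one_div_hat]
  have h1 : α - 1 ≠ 0 := sub_ne_zero.mpr hα1
  have h2 : β - 1 ≠ 0 := sub_ne_zero.mpr hβ1
  have h3 : γ - 1 ≠ 0 := sub_ne_zero.mpr hγ1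
  field_simp
  linear_combination -hrel

lemma one_div_add_one_div_sub_two (hβ : 0 < β) (hγ : 0 < γ) :
    (1 / β + 1 / γ - 2) * (β * γ) = β + γ - 2 * β * γ := by
  field_simp
  ring

/-- The relation is (α-1)(βγ-1) = (β-1)(γ-1), and β + γ < 2βγ forces βγ > 1. Hence α-1 has the sign
of (β-1)(γ-1), and β, γ cannot both be below 1. -/
lemma orders_of_lt (hβ : 0 < β) (hγ : 0 < γ) (hβ1 : β ≠ 1) (hγ1 : γ ≠ 1)
    (hrel : α * β * γ - 2 * β * γ - α + β + γ = 0) (h : β + γ < 2 * β * γ) :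
    (1 < α ∧ 1 < β ∧ 1 < γ) ∨ (α < 1 ∧ 1 < β ∧ γ < 1) ∨ (α < 1 ∧ β < 1 ∧ 1 < γ) := by
  have e : (α - 1) * (β * γ - 1) = (β - 1) * (γ - 1) := by linear_combination hrel
  rcases lt_or_gt_of_ne hβ1 with hb | hb <;> rcases lt_or_gt_of_ne hγ1 with hg | hg
  · nlinarith
  · have h1 : 0 < β * γ - 1 := by nlinarith
    have h2 : (β - 1) * (γ - 1) < 0 := mul_neg_of_neg_of_pos (by linarith) (by linarith)
    exact Or.inr (Or.inr ⟨by nlinarith, hb, hg⟩)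
  · have h1 : 0 < β * γ - 1 := by nlinarith
    have h2 : (β - 1) * (γ - 1) < 0 := mul_neg_of_pos_of_neg (by linarith) (by linarith)
    exact Or.inr (Or.inl ⟨by nlinarith, hb, hg⟩)
  · have h1 : 0 < β * γ - 1 := by nlinarith
    have h2 : 0 < (β - 1) * (γ - 1) := mul_pos (by linarith) (by linarith)
    exact Or.inl ⟨by nlinarith, hb, hg⟩

/-- The relation also reads α(βγ-1) = 2βγ - β - γ, so α > 0 gives βγ < 1. Hence α-1 has the sign
opposite to (β-1)(γ-1). -/
lemma orders_of_gt (hα : 0 < α) (hβ1 : β ≠ 1) (hγ1 : γ ≠ 1)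
    (hrel : α * β * γ - 2 * β * γ - α + β + γ = 0) (h : 2 * β * γ < β + γ) :
    (1 < α ∧ 1 < β ∧ γ < 1) ∨ (1 < α ∧ β < 1 ∧ 1 < γ) ∨ (α < 1 ∧ β < 1 ∧ γ < 1) := by
  have e : (α - 1) * (β * γ - 1) = (β - 1) * (γ - 1) := by linear_combination hrel
  have h1 : β * γ - 1 < 0 := by
    by_contra! h'
    nlinarith [mul_nonneg hα.le h']
  rcases lt_or_gt_of_ne hβ1 with hb | hb <;> rcases lt_or_gt_of_ne hγ1 with hg | hg
  · have h2 : 0 < (β - 1) * (γ - 1) := mul_pos_of_neg_of_neg (by linarith) (by linarith)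
    exact Or.inr (Or.inr ⟨by nlinarith, hb, hg⟩)
  · have h2 : (β - 1) * (γ - 1) < 0 := mul_neg_of_neg_of_pos (by linarith) (by linarith)
    exact Or.inr (Or.inl ⟨by nlinarith, hb, hg⟩)
  · have h2 : (β - 1) * (γ - 1) < 0 := mul_neg_of_pos_of_neg (by linarith) (by linarith)
    exact Or.inl ⟨by nlinarith, hb, hg⟩
  · nlinarith

end Exponents

/-! ### Assembly of all orders. -/

section Main

variable {A B : Type*} [Fintype A] [DecidableEq A] [Fintype B] [DecidableEq B]

lemma renyiDiv_le_relEntropy {n : Type*} [Fintype n] [DecidableEq n] {ρ κ : Matrix n n ℂ}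
    (hρ : IsDensity ρ) (hκ : κ.PosSemidef) {p : ℝ} (hp0 : 0 ≤ p) (hp : p ≤ 1) :
    renyiDiv p ρ κ ≤ relEntropy ρ κ := by
  unfold renyiDiv
  split_ifs with h0 h1
  · refine Filter.limsup_le_of_le (by isBoundedDefault) ?_
    filter_upwards [Ioo_mem_nhdsGT (zero_lt_one (α := ℝ))] with a ha
    exact sandwichedDiv_le_relEntropy hρ hκ ha.1 ha.2
  · exact le_rfl
  · exact sandwichedDiv_le_relEntropy hρ hκ (lt_of_le_of_ne hp0 (Ne.symm h0)) (lt_of_le_of_ne hp h1)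

lemma relEntropy_le_renyiDiv {n : Type*} [Fintype n] [DecidableEq n] {ρ κ : Matrix n n ℂ}
    (hρ : IsDensity ρ) (hκ : κ.PosSemidef) {p : ℝ} (hp : 1 ≤ p) :
    relEntropy ρ κ ≤ renyiDiv p ρ κ := by
  unfold renyiDiv
  split_ifs with h0 h1
  · linarith
  · exact le_rfl
  · exact relEntropy_le_sandwichedDiv hρ hκ (lt_of_le_of_ne hp (Ne.symm h1))

lemma renyiDiv_eq_sandwichedDiv {n : Type*} [Fintype n] [DecidableEq n] (ρ κ : Matrix n n ℂ)
    {p : ℝ} (h0 : p ≠ 0) (h1 : p ≠ 1) : renyiDiv p ρ κ = sandwichedDiv p ρ κ := by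
  rw [renyiDiv, if_neg h0, if_neg h1]

lemma renyiDiv_one {n : Type*} [Fintype n] [DecidableEq n] (ρ κ : Matrix n n ℂ) :
    renyiDiv 1 ρ κ = relEntropy ρ κ := by
  rw [renyiDiv, if_neg one_ne_zero, if_pos rfl]

variable {α β γ : ℝ}

theorem renyiEntropy_add_renyiDiv_le (hrel : α * β * γ - 2 * β * γ - α + β + γ = 0)
    (hα : 0 ≤ α) (hβ : 1 / 2 < β) (hγ : 0 < γ)
    (h : β + γ < 2 * β * γ ∨ (β + γ = 2 * β * γ ∧ α ≤ 1))
    {ρ : Matrix (A × B) (A × B) ℂ} (hρ : IsDensity ρ) {τ : Matrix A A ℂ} (hτ : τ.PosSemidef)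
    {σ : Matrix B B ℂ} (hσ : IsDensity σ) :
    (renyiEntropy γ (reducedRight ρ) : EReal) + renyiDiv α ρ (τ ⊗ₖ (1 : Matrix B B ℂ)) ≤
      renyiDiv β ρ (τ ⊗ₖ σ) := by
  have hβ0 : 0 < β := by linarith
  have hτ1 : (τ ⊗ₖ (1 : Matrix B B ℂ)).PosSemidef := hτ.kronecker Matrix.PosSemidef.one
  have hτσ : (τ ⊗ₖ σ).PosSemidef := hτ.kronecker hσ.1
  have hprod := renyiEntropy_one_add_relEntropy_le hρ hτ hσ
  have e : (α - 1) * (β * γ - 1) = (β - 1) * (γ - 1) := by linear_combination hrel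
  -- If γ = 1 then (α-1)(β-1) = 0, and the hypotheses give α ≤ 1 ≤ β. The order-one chain rule lies
  -- between the two sides.
  rcases eq_or_ne γ 1 with rfl | hγ1
  · have hβ1 : 1 ≤ β := by rcases h with h | h <;> linarith
    have hα1 : α ≤ 1 := by
      rcases h with h | h
      · nlinarith
      · exact h.2
    exact (add_le_add_right (renyiDiv_le_relEntropy hρ hτ1 hα hα1) _).trans
      (hprod.trans (relEntropy_le_renyiDiv hρ hτσ hβ1))
  rcases eq_or_ne β 1 with rfl | hβ1
  · have hγ1' : 1 < γ := lt_of_le_of_ne (by rcases h with h | h <;> linarith) hγ1.symm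
    have hα1 : α ≤ 1 := by nlinarith
    have hH : renyiEntropy γ (reducedRight ρ) ≤ renyiEntropy 1 (reducedRight ρ) := by
      have := mul_renyiEntropy_one_sub_nonneg (reducedRight_isDensity hρ) hγ
      linarith [nonneg_of_mul_nonneg_right this (by linarith)]
    rw [renyiDiv_one]
    exact (add_le_add (EReal.coe_le_coe_iff.mpr hH)
      (renyiDiv_le_relEntropy hρ hτ1 hα hα1)).trans hprod
  have hα1 : α ≠ 1 := by
    rintro rfl
    rw [sub_self, zero_mul, eq_comm, mul_eq_zero] at e
    exact e.elim (sub_ne_zero.mpr hβ1) (sub_ne_zero.mpr hγ1)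
  rw [renyiDiv_eq_sandwichedDiv _ _ hβ0.ne' hβ1]
  rcases hα.eq_or_lt with rfl | hα0
  · rw [renyiDiv, if_pos rfl]
    exact renyiEntropy_add_limsup_le hβ hγ hβ1 (by linarith) hρ hτ hσ
  · rw [renyiDiv_eq_sandwichedDiv _ _ hα0.ne' hα1]
    -- In the equality case α > 0 would force βγ = 1 and β + γ = 2, hence β = 1.
    have hlt : β + γ < 2 * β * γ := by
      rcases h with h | h
      · exact h
      · have h1 : β * γ = 1 := by
          have : α * (β * γ - 1) = 0 := by linear_combination hrel - h.1
          linarith [(mul_eq_zero.mp this).resolve_left hα0.ne']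
        have : (β - 1) ^ 2 = 0 := by
          have h2 : γ = 2 - β := by linarith [h.1]
          rw [h2] at h1; linarith
        exact absurd (by linarith [pow_eq_zero_iff (two_ne_zero) |>.mp this]) hβ1
    exact renyiEntropy_add_sandwichedDiv_le hα0 hβ0 hγ (one_div_hat_eq_add hα1 hβ1 hγ1 hrel)
      (orders_of_lt hβ0 hγ hβ1 hγ1 hrel hlt) hρ hτ hσ

theorem exists_renyiDiv_le_renyiEntropy_add (hrel : α * β * γ - 2 * β * γ - α + β + γ = 0)
    (hα : 0 ≤ α) (hβ : 0 < β) (hγ : 0 < γ)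
    (h : 2 * β * γ < β + γ ∨ (β + γ = 2 * β * γ ∧ 1 ≤ α))
    {ρ : Matrix (A × B) (A × B) ℂ} (hρ : IsDensity ρ) {τ : Matrix A A ℂ} (hτ : τ.PosSemidef) :
    ∃ σ : Matrix B B ℂ, IsDensity σ ∧ renyiDiv β ρ (τ ⊗ₖ σ) ≤
      (renyiEntropy γ (reducedRight ρ) : EReal) + renyiDiv α ρ (τ ⊗ₖ (1 : Matrix B B ℂ)) := by
  have hρB := reducedRight_isDensity hρ
  have hτ1 : (τ ⊗ₖ (1 : Matrix B B ℂ)).PosSemidef := hτ.kronecker Matrix.PosSemidef.one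
  have hτσ : (τ ⊗ₖ reducedRight ρ).PosSemidef := hτ.kronecker hρB.1
  have hprod := relEntropy_reducedRight_le hρ hτ
  have e : (α - 1) * (β * γ - 1) = (β - 1) * (γ - 1) := by linear_combination hrel
  rcases eq_or_ne γ 1 with rfl | hγ1
  · have hβ1 : β ≤ 1 := by rcases h with h | h <;> linarith
    have hα1 : 1 ≤ α := by
      rcases h with h | h
      · nlinarith
      · exact h.2
    exact ⟨_, hρB, (renyiDiv_le_relEntropy hρ hτσ hβ.le hβ1).trans
      (hprod.trans (add_le_add_right (relEntropy_le_renyiDiv hρ hτ1 hα1) _))⟩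
  rcases eq_or_ne β 1 with rfl | hβ1
  · have hγ1' : γ < 1 := lt_of_le_of_ne (by rcases h with h | h <;> linarith) hγ1
    have hα1 : 1 ≤ α := by nlinarith
    have hH : renyiEntropy 1 (reducedRight ρ) ≤ renyiEntropy γ (reducedRight ρ) := by
      have := mul_renyiEntropy_one_sub_nonneg hρB hγ
      linarith [nonpos_of_mul_nonneg_right this (by linarith)]
    refine ⟨_, hρB, ?_⟩
    rw [renyiDiv_one]
    exact hprod.trans (add_le_add (EReal.coe_le_coe_iff.mpr hH)
      (relEntropy_le_renyiDiv hρ hτ1 hα1))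
  have hα1 : α ≠ 1 := by
    rintro rfl
    rw [sub_self, zero_mul, eq_comm, mul_eq_zero] at e
    exact e.elim (sub_ne_zero.mpr hβ1) (sub_ne_zero.mpr hγ1)
  -- At α = 0 the relation is β + γ = 2βγ, where α ≥ 1 is required.
  have hα0 : 0 < α := by
    refine lt_of_le_of_ne hα fun h0 => ?_
    subst h0
    rcases h with h | h <;> linarith [h]
  have hlt : 2 * β * γ < β + γ := by
    rcases h with h | h
    · exact h
    · have h1 : β * γ = 1 := by
        have : α * (β * γ - 1) = 0 := by linear_combination hrel - h.1
        linarith [(mul_eq_zero.mp this).resolve_left hα0.ne']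
      have : (β - 1) ^ 2 = 0 := by
        have h2 : γ = 2 - β := by linarith [h.1]
        rw [h2] at h1; linarith
      exact absurd (by linarith [pow_eq_zero_iff (two_ne_zero) |>.mp this]) hβ1
  obtain ⟨σ, hσ, hle⟩ := exists_sandwichedDiv_le_renyiEntropy_add hα0 hβ hγ
    (one_div_hat_eq_add hα1 hβ1 hγ1 hrel) (orders_of_gt hα0 hβ1 hγ1 hrel hlt) hρ hτ
  refine ⟨σ, hσ, ?_⟩
  rwa [renyiDiv_eq_sandwichedDiv _ _ hβ.ne' hβ1, renyiDiv_eq_sandwichedDiv _ _ hα0.ne' hα1]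

end Main

end Renyi

theorem theoremA1 {A B : Type*} [Fintype A] [DecidableEq A] [Fintype B] [DecidableEq B]
    (α β γ : ℝ) (hrel : α * β * γ - 2 * β * γ - α + β + γ = 0)
    (hα : 0 ≤ α) (hβ : 1 / 2 < β) (hγ : 1 / 2 ≤ γ)
    (ρ : Matrix (A × B) (A × B) ℂ) (hρ : Renyi.IsDensity ρ)
    (τ : Matrix A A ℂ) (hτ : τ.PosSemidef) :
    ((1 / β + 1 / γ < 2 ∨ (1 / β + 1 / γ = 2 ∧ α ≤ 1)) →
      Renyi.mutualInfo β ρ τ ≥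
        (Renyi.renyiEntropy γ (Renyi.reducedRight ρ) : EReal) - Renyi.condEntropy α ρ τ) ∧
    ((1 / β + 1 / γ > 2 ∨ (1 / β + 1 / γ = 2 ∧ 1 ≤ α)) →
      Renyi.mutualInfo β ρ τ ≤
        (Renyi.renyiEntropy γ (Renyi.reducedRight ρ) : EReal) - Renyi.condEntropy α ρ τ) := by
  have hβ0 : 0 < β := by linarith
  have hγ0 : 0 < γ := by linarith
  have hm := Renyi.one_div_add_one_div_sub_two hβ0 hγ0
  have hβγ : 0 < β * γ := mul_pos hβ0 hγ0
  have heq : 1 / β + 1 / γ = 2 → β + γ = 2 * β * γ := by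
    intro h; rw [h] at hm; linarith
  -- Subtracting the conditional entropy adds D_α(ρ‖τ ⊗ 1). The first part then holds for every σ
  -- under the infimum, while the second needs only one σ.
  rw [Renyi.condEntropy, sub_eq_add_neg, neg_neg]
  constructor
  · intro h
    refine le_iInf₂ fun σ hσ => Renyi.renyiEntropy_add_renyiDiv_le hrel hα hβ hγ0 ?_ hρ hτ hσ
    refine h.imp (fun h => ?_) (fun h => ⟨heq h.1, h.2⟩)
    linarith [mul_neg_of_neg_of_pos (sub_neg.mpr h) hβγ]
  · intro h
    obtain ⟨σ, hσ, hle⟩ := Renyi.exists_renyiDiv_le_renyiEntropy_add hrel hα hβ0 hγ0 (by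
      refine h.imp (fun h => ?_) (fun h => ⟨heq h.1, h.2⟩)
      linarith [mul_pos (sub_pos.mpr h) hβγ]) hρ hτ
    exact (iInf₂_le σ hσ).trans hle
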